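/- Conventions. Let $\mathcal A=M_d(\mathbb C)$ be the observable algebra of each spin of a chain indexed by $\mathbb Z$. A state $\omega$ of the infinite chain is given by its density matrices $\rho_\Lambda$ on $\mathcal A^{\otimes\Lambda}$ for all finite $\Lambda\subset\mathbb Z$, consistent under partial traces. It is translation invariant if $\rho_{\Lambda+k}$ is the translate of $\rho_\Lambda$ for all $k\in\mathbb Z$, and pure if it is not a nontrivial convex combination of states of the chain. It is finitely correlated (an FCS) if there are $b\in\mathbb N$, a completely positive unital map $\mathbb E:\mathcal A\otimes M_b(\mathbb C)\to M_b(\mathbb C)$ and a $b\times b$ density matrix $\rho$ with $\operatorname{Tr}\rho\,\mathbb E(\mathbf 1\otimes B)=\operatorname{Tr}\rho B$ for all $B\in M_b(\mathbb C)$, such that for all $n$ and $A_1,\dots,A_n\in\mathcal A$ $$\operatorname{Tr}\bigl(\rho_{[1,n]}\,A_1\otimes\cdots\otimes A_n\bigr)=\operatorname{Tr}\bigl(\rho\,\mathbb E(A_1\otimes\mathbb E(A_2\otimes\cdots\otimes\mathbb E(A_n\otimes\mathbf 1)\cdots))\bigr).$$ For a density matrix $\sigma_{12}$ on a bipartite system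 $\mathcal X_1\otimes\mathcal X_2$, the entanglement of formation is $$\mathrm{EoF}_{\mathcal X_1,\mathcal X_2}(\sigma_{12})=\inf\sum_i p_i\,S\bigl(\operatorname{Tr}_{\mathcal X_2}\sigma_{12}^i\bigr),\qquad S(\tau)=-\operatorname{Tr}\tau\ln\tau,$$ the infimum being over all finite convex decompositions $\sigma_{12}=\sum_i p_i\sigma_{12}^i$ into pure states. Let $\rho_{1,[p,n]}$ denote the density matrix of $\omega$ on the sites $\{1\}\cup\{p,p+1,\dots,n\}$. Theorem. There is an absolute constant $C>0$ such that for every $d$ and every pure translation invariant FCS $\omega$ with spin dimension $d$ there is a nonnegative sequence $\epsilon(p)$ (depending on $\omega$ only), decaying exponentially, i.e. $0\le\epsilon(p)\le K r^p$ for all $p$ with some $K$ and some $0<r<1$, such that for all integers $n\ge p\ge 2$ $$\mathrm{EoF}_{\mathcal A,\,\mathcal A^{\otimes n-p+1}}\bigl(\rho_{1,[p,n]}\bigr)\le C\,\ln d\,(n-p+1)\,\epsilon(p).$$ -/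

import Mathlib

open scoped Kronecker ComplexOrder

noncomputable section

namespace SpinChain

/-! ### Density matrices, partial trace, entropy, entanglement of formation -/

/-- A density matrix: positive semidefinite of trace one. -/
def IsDensityMatrix {m : Type*} [Fintype m] (M : Matrix m m ℂ) : Prop :=
  M.PosSemidef ∧ M.trace = 1

/-- The partial trace over the second factor of a bipartite system. -/
def partialTraceRight {m n : Type*} [Fintype n] (M : Matrix (m × n) (m × n) ℂ) :
    Matrix m m ℂ :=
  Matrix.of fun i j => ∑ k, M (i, k) (j, k)

/-- The von Neumann entropy `S(ρ) = -Tr ρ log ρ` (natural logarithm, `0 log 0 = 0`), through the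
functional calculus of the function `x ↦ -x log x`. -/
def vonNeumannEntropy {m : Type*} [Fintype m] [DecidableEq m] (M : Matrix m m ℂ) : ℝ :=
  (Matrix.trace (cfc Real.negMulLog M)).re

/-- The rank-one matrix `|ψ⟩⟨ψ|`. -/
def ketBra {m : Type*} (ψ : m → ℂ) : Matrix m m ℂ :=
  Matrix.vecMulVec ψ (star ψ)

/-- `σ = ∑ i, p i |ψ i⟩⟨ψ i|` is a convex decomposition of `σ` into (normalized) pure states. -/
structure IsPureDecomposition {m : Type*} [Fintype m] (σ : Matrix m m ℂ) {k : ℕ}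
    (p : Fin k → ℝ) (ψ : Fin k → m → ℂ) : Prop where
  nonneg : ∀ i, 0 ≤ p i
  sum_eq_one : ∑ i, p i = 1
  normalized : ∀ i, ∑ a, ‖ψ i a‖ ^ 2 = 1
  decomposes : σ = ∑ i, (p i : ℂ) • ketBra (ψ i)

/-- The entanglement of formation of a bipartite density matrix: the infimum, over all convex
decompositions into pure states, of the average entropy of the reductions to the first factor. -/
def entanglementOfFormation {m n : Type*} [Fintype m] [Fintype n] [DecidableEq m]
    (σ : Matrix (m × n) (m × n) ℂ) : ℝ :=
  sInf {e : ℝ | ∃ (k : ℕ) (p : Fin k → ℝ) (ψ : Fin k → m × n → ℂ),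
    IsPureDecomposition σ p ψ ∧
      e = ∑ i, p i * vonNeumannEntropy (partialTraceRight (ketBra (ψ i)))}

/-! ### States of the infinite chain

The spin at each site of `ℤ` has observable algebra `M_d(ℂ)`; the observables of a finite region
`Λ` are the matrices indexed by the configurations `Λ → Fin d`. -/

/-- The configuration of `Λ'` that agrees with `x` on `Λ` and with `z` on `Λ' \ Λ`. -/
def glue {d : ℕ} {Λ Λ' : Finset ℤ} (x : Λ → Fin d) (z : ↥(Λ' \ Λ) → Fin d) : Λ' → Fin d :=
  fun j => if h : (j : ℤ) ∈ Λ then x ⟨j, h⟩ else z ⟨j, Finset.mem_sdiff.mpr ⟨j.2, h⟩⟩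

/-- The partial trace over the sites in `Λ' \ Λ` (used for `Λ ⊆ Λ'`). -/
def restrict {d : ℕ} (Λ Λ' : Finset ℤ) (M : Matrix (Λ' → Fin d) (Λ' → Fin d) ℂ) :
    Matrix (Λ → Fin d) (Λ → Fin d) ℂ :=
  Matrix.of fun x y => ∑ z : ↥(Λ' \ Λ) → Fin d, M (glue x z) (glue y z)

/-- A state of the quasi-local algebra of the chain, given by its density matrices on all finite
regions; these are exactly the families that are consistent under partial traces. -/
structure ChainState (d : ℕ) where
  rho : (Λ : Finset ℤ) → Matrix (Λ → Fin d) (Λ → Fin d) ℂ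
  isDensity : ∀ Λ, IsDensityMatrix (rho Λ)
  consistent : ∀ Λ Λ' : Finset ℤ, Λ ⊆ Λ' → restrict Λ Λ' (rho Λ') = rho Λ

/-- The region `Λ + k`. -/
def shift (Λ : Finset ℤ) (k : ℤ) : Finset ℤ := Λ.map (addRightEmbedding k)

/-- A configuration of `Λ + k`, seen as a configuration of `Λ`. -/
def unshift {d : ℕ} {Λ : Finset ℤ} {k : ℤ} (x : ↥(shift Λ k) → Fin d) : Λ → Fin d :=
  fun j => x ⟨j + k, Finset.mem_map_of_mem (addRightEmbedding k) j.2⟩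

/-- Elementary tensor `⊗_{j ∈ Λ} A j`. -/
def tensor {d : ℕ} (Λ : Finset ℤ) (A : ℤ → Matrix (Fin d) (Fin d) ℂ) :
    Matrix (Λ → Fin d) (Λ → Fin d) ℂ :=
  Matrix.of fun x y => ∏ j : Λ, A j (x j) (y j)

/-- Complete positivity of a linear map between matrix algebras: all ampliations `id_k ⊗ Φ`
preserve positive semidefiniteness. -/
def IsCompletelyPositive {m n : Type*} [Fintype m] [Fintype n]
    (Φ : Matrix m m ℂ →ₗ[ℂ] Matrix n n ℂ) : Prop :=
  ∀ (k : ℕ) (X : Matrix (Fin k × m) (Fin k × m) ℂ), X.PosSemidef →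
    (Matrix.of fun u v : Fin k × n =>
      Φ (Matrix.of fun a b => X (u.1, a) (v.1, b)) u.2 v.2).PosSemidef

/-- `𝔼(A₁ ⊗ 𝔼(A₂ ⊗ ⋯ 𝔼(Aₙ ⊗ 1)⋯))` for the list `[A₁, …, Aₙ]`. -/
def nested {d b : ℕ}
    (E : Matrix (Fin d × Fin b) (Fin d × Fin b) ℂ →ₗ[ℂ] Matrix (Fin b) (Fin b) ℂ) :
    List (Matrix (Fin d) (Fin d) ℂ) → Matrix (Fin b) (Fin b) ℂ
  | [] => 1
  | A :: l => E (A ⊗ₖ nested E l)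

namespace ChainState

variable {d : ℕ}

/-- Invariance under all lattice translations. -/
def IsTranslationInvariant (ω : ChainState d) : Prop :=
  ∀ (Λ : Finset ℤ) (k : ℤ),
    ω.rho (shift Λ k) = Matrix.of fun x y => ω.rho Λ (unshift x) (unshift y)

/-- Purity: `ω` is not a nontrivial convex combination of states of the chain (translation
invariant or not). -/
def IsPure (ω : ChainState d) : Prop :=
  ∀ (φ ψ : ChainState d) (t : ℝ), 0 < t → t < 1 →
    (∀ Λ, ω.rho Λ = (t : ℂ) • φ.rho Λ + ((1 - t : ℝ) : ℂ) • ψ.rho Λ) → φ = ω ∧ ψ = ω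

/-- Finitely correlated state: there are a memory algebra `M_b(ℂ)`, a completely positive unital
map `𝔼 : M_d ⊗ M_b → M_b` and a density matrix `ρ` on the memory, invariant under
`B ↦ 𝔼(1 ⊗ B)`, such that
`Tr (ρ_{[1,n]} A₁ ⊗ ⋯ ⊗ Aₙ) = Tr (ρ 𝔼(A₁ ⊗ 𝔼(A₂ ⊗ ⋯ 𝔼(Aₙ ⊗ 1)⋯)))` for all `n`. -/
def IsFinitelyCorrelated (ω : ChainState d) : Prop :=
  ∃ (b : ℕ)
    (E : Matrix (Fin d × Fin b) (Fin d × Fin b) ℂ →ₗ[ℂ] Matrix (Fin b) (Fin b) ℂ)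
    (ρ : Matrix (Fin b) (Fin b) ℂ),
    IsCompletelyPositive E ∧ E 1 = 1 ∧ IsDensityMatrix ρ ∧
    (∀ B : Matrix (Fin b) (Fin b) ℂ,
      (ρ * E ((1 : Matrix (Fin d) (Fin d) ℂ) ⊗ₖ B)).trace = (ρ * B).trace) ∧
    ∀ (n : ℕ) (A : ℤ → Matrix (Fin d) (Fin d) ℂ),
      (ω.rho (Finset.Icc 1 (n : ℤ)) * tensor (Finset.Icc 1 (n : ℤ)) A).trace =
        (ρ * nested E ((List.range n).map fun k : ℕ => A ((k : ℤ) + 1))).trace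

/-- The density matrix of the site `i` together with the region `Λ` (used for `i ∉ Λ`), as a
bipartite density matrix over `M_d ⊗ M_d^{⊗ Λ}`. -/
def siteRegion (ω : ChainState d) (i : ℤ) (Λ : Finset ℤ) :
    Matrix (Fin d × (Λ → Fin d)) (Fin d × (Λ → Fin d)) ℂ :=
  let join : Fin d × (Λ → Fin d) → (↥(insert i Λ) → Fin d) :=
    fun s j => if h : (j : ℤ) ∈ Λ then s.2 ⟨j, h⟩ else s.1
  (ω.rho (insert i Λ)).submatrix join join

/-- `ρ_{1,[p,n]}`, the joint density matrix of spin `1` and the block of spins `[p,n]`. -/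
def spinBlock (ω : ChainState d) (p n : ℕ) :
    Matrix (Fin d × (↥(Finset.Icc (p : ℤ) (n : ℤ)) → Fin d))
      (Fin d × (↥(Finset.Icc (p : ℤ) (n : ℤ)) → Fin d)) ℂ :=
  ω.siteRegion 1 (Finset.Icc (p : ℤ) (n : ℤ))

end ChainState

/-- Exponential decay of a nonnegative sequence. -/
def DecaysExponentially (ε : ℕ → ℝ) : Prop :=
  ∃ K r : ℝ, 0 < r ∧ r < 1 ∧ ∀ p, 0 ≤ ε p ∧ ε p ≤ K * r ^ p

end SpinChain

end

/-!
Write `σ` for the joint density matrix of spin `1` and the block `[p, n]`. The bound follows from two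
facts: `σ` is close in trace norm to the product of its marginals, with an error exponentially small
in `p` and uniform in `n`; and a state close to a product state has small entanglement of formation,
with a bound that involves only the dimension `d` of the single spin. The factor `n - p + 1 ≥ 1` only
weakens the bound, and `C = 1` works because `ε` may depend on `ω`.

*Clustering.* Move the single spin to `-∞` while the block stays fixed. For `0 ≤ A ≤ 1` with
expectation strictly between `0` and `1`, every ultrafilter limit of the (normalized) states obtained
from `ω` by observing `A`, respectively `1 - A`, at the moving spin is a state of the chain, and `ω`
is a convex combination of the two. Purity forces both to be `ω`, so that the joint density
matrix converges to the product of the marginals (`IsPure.tendsto_siteRegion`).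

*Exponential rate.* In a finitely correlated state every correlation of a spin and a block at
distance `k` is of the form `F (Φ ^ k v)`, with `Φ` and `F` on a finite-dimensional space independent
of the block (`IsFinitelyCorrelated.exists_orbit`). Orbit sequences that tend to zero form a
finite-dimensional shift-invariant space on which the powers of the shift tend strongly, hence in
norm and exponentially, to zero (`exists_exponential_bound`). As the constant involves only the
supremum of the sequence, which is at most `2` for a test matrix `-1 ≤ S ≤ 1`, the trace norm decays
uniformly in the block (`IsPure.exists_norm_trace_le`).

*Entanglement of formation near a product.* Decompose `σ` into the vectors `√σ e`, where `e` runs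
through a product eigenbasis of the product state `τ`. By the Powers–Størmer inequality these vectors
are close, in mean square, to multiples of the product vectors `e`, so their reductions have small
linear entropy, and hence small von Neumann entropy (`entanglementOfFormation_le_of_near_product`).
-/

open Matrix Filter Topology

noncomputable section

namespace SpinChain

/-! ### Exponential decay from finite-dimensionality -/

/-- In finite dimension, strong convergence to zero of the powers of an operator is exponential
convergence in norm. -/
theorem exists_norm_pow_le_of_tendsto_zero {Z : Type*} [NormedAddCommGroup Z] [NormedSpace ℂ Z]
    [FiniteDimensional ℂ Z] (T : Z →L[ℂ] Z)
    (hT : ∀ z, Tendsto (fun k : ℕ => (T ^ k) z) atTop (𝓝 0)) :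
    ∃ K r : ℝ, 0 ≤ K ∧ 0 < r ∧ r < 1 ∧ ∀ k, ‖T ^ k‖ ≤ K * r ^ k := by
  have hlim : Tendsto (fun k : ℕ => T ^ k) atTop (𝓝 0) := by
    let c : (Z →L[ℂ] Z) →ₗ[ℂ] (Z → Z) :=
      { toFun := fun S z => S z
        map_add' := fun _ _ => rfl
        map_smul' := fun _ _ => rfl }
    have hc : Function.Injective c := fun S S' h => ContinuousLinearMap.ext fun z => congrFun h z
    have hemb := LinearMap.isClosedEmbedding_of_injective (f := c) (LinearMap.ker_eq_bot.2 hc)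
    rw [hemb.isEmbedding.tendsto_nhds_iff, map_zero]
    exact tendsto_pi_nhds.2 hT
  obtain ⟨N, hN, hN0⟩ : ∃ N : ℕ, ‖T ^ N‖ < 1 / 2 ∧ 0 < N := by
    have h1 : ∀ᶠ k : ℕ in atTop, ‖T ^ k‖ < 1 / 2 := by
      have := hlim.norm
      rw [norm_zero] at this
      exact this.eventually_lt_const (by norm_num)
    exact (h1.and (eventually_gt_atTop 0)).exists
  have hr0 : (0 : ℝ) < (1 / 2 : ℝ) ^ ((N : ℝ)⁻¹) := by positivity
  have hr1 : (1 / 2 : ℝ) ^ ((N : ℝ)⁻¹) < 1 :=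
    Real.rpow_lt_one (by norm_num) (by norm_num) (by positivity)
  have hrN : ((1 / 2 : ℝ) ^ ((N : ℝ)⁻¹)) ^ N = 1 / 2 :=
    Real.rpow_inv_natCast_pow (by norm_num) hN0.ne'
  set r : ℝ := (1 / 2 : ℝ) ^ ((N : ℝ)⁻¹)
  refine ⟨∑ s ∈ Finset.range N, ‖T ^ s‖ / r ^ s, r,
    Finset.sum_nonneg fun _ _ => by positivity, hr0, hr1, fun k => ?_⟩
  induction k using Nat.strong_induction_on with
  | _ k ih =>
    rcases lt_or_ge k N with hk | hk
    · have := Finset.single_le_sum (f := fun s => ‖T ^ s‖ / r ^ s)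
        (fun s _ => by positivity) (Finset.mem_range.2 hk)
      rwa [div_le_iff₀ (by positivity)] at this
    · obtain ⟨l, rfl⟩ := Nat.exists_eq_add_of_le hk
      have hl := ih l (by omega)
      calc ‖T ^ (N + l)‖ ≤ ‖T ^ N‖ * ‖T ^ l‖ := by rw [pow_add]; exact norm_mul_le _ _
        _ ≤ r ^ N * ((∑ s ∈ Finset.range N, ‖T ^ s‖ / r ^ s) * r ^ l) := by
            rw [hrN]; gcongr
        _ = _ := by ring

/-- The orbit sequences `k ↦ f (Φ ^ k v)` that tend to zero form a finite-dimensional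
shift-invariant space of null sequences, so they decay exponentially at a common rate, with a
constant that depends only on the supremum of the sequence. -/
theorem exists_exponential_bound {V : Type*} [AddCommGroup V] [Module ℂ V]
    [FiniteDimensional ℂ V] (Φ : V →ₗ[ℂ] V) (f : V →ₗ[ℂ] ℂ) :
    ∃ K r : ℝ, 0 ≤ K ∧ 0 < r ∧ r < 1 ∧ ∀ v, Tendsto (fun k => f ((Φ ^ k) v)) atTop (𝓝 0) →
      ∀ c, (∀ k, ‖f ((Φ ^ k) v)‖ ≤ c) → ∀ k, ‖f ((Φ ^ k) v)‖ ≤ K * r ^ k * c := by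
  let orbit : V →ₗ[ℂ] (ℕ → ℂ) := LinearMap.pi fun k => f ∘ₗ (Φ ^ k)
  let Z : Submodule ℂ (BoundedContinuousFunction ℕ ℂ) :=
    { carrier := {u | Tendsto (fun k => u k) atTop (𝓝 0) ∧ ∃ v, ∀ k, u k = f ((Φ ^ k) v)}
      add_mem' := by
        rintro u u' ⟨h1, v, hv⟩ ⟨h2, v', hv'⟩
        refine ⟨by simpa using h1.add h2, v + v', fun k => ?_⟩
        simp [hv, hv']
      zero_mem' := ⟨by simp, 0, by simp⟩
      smul_mem' := by
        rintro c u ⟨h1, v, hv⟩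
        refine ⟨by simpa using h1.const_mul c, c • v, fun k => ?_⟩
        simp [hv] }
  have hfin : FiniteDimensional ℂ Z := by
    let J : Z →ₗ[ℂ] LinearMap.range orbit :=
      { toFun := fun u => ⟨fun k => u.1 k, by
          obtain ⟨-, v, hv⟩ := u.2
          exact ⟨v, funext fun k => (hv k).symm⟩⟩
        map_add' := fun _ _ => rfl
        map_smul' := fun _ _ => rfl }
    refine Module.Finite.of_injective J fun u u' h => Subtype.ext ?_
    ext k
    exact congrFun (congrArg Subtype.val h) k
  let T : Z →ₗ[ℂ] Z :=
    { toFun := fun u => ⟨u.1.compContinuous ⟨fun k : ℕ => k + 1, continuous_of_discreteTopology⟩, by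
        obtain ⟨h1, v, hv⟩ := u.2
        refine ⟨(tendsto_add_atTop_iff_nat 1).2 h1, Φ v, fun k => ?_⟩
        have := hv (k + 1)
        rw [pow_succ] at this
        exact this⟩
      map_add' := fun _ _ => rfl
      map_smul' := fun _ _ => rfl }
  have hTpow : ∀ (k : ℕ) (u : Z) (j : ℕ),
      ((LinearMap.toContinuousLinearMap T ^ k) u).1 j = u.1 (j + k) := by
    intro k
    induction k with
    | zero => intro u j; rfl
    | succ k ih =>
      intro u j
      rw [pow_succ]
      change ((LinearMap.toContinuousLinearMap T ^ k) (T u)).1 j = _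
      rw [ih]
      change u.1 (j + k + 1) = _
      rw [add_assoc]
  obtain ⟨K, r, hK, hr0, hr1, hb⟩ :=
    exists_norm_pow_le_of_tendsto_zero (LinearMap.toContinuousLinearMap T) fun u => by
      rw [Metric.tendsto_atTop]
      intro ε hε
      obtain ⟨N, hN⟩ := Metric.tendsto_atTop.1 u.2.1 (ε / 2) (by positivity)
      refine ⟨N, fun k hk => ?_⟩
      rw [dist_zero_right]
      refine lt_of_le_of_lt ?_ (half_lt_self hε)
      refine (BoundedContinuousFunction.norm_le (by positivity)).2 fun j => ?_
      change ‖((LinearMap.toContinuousLinearMap T ^ k) u).1 j‖ ≤ ε / 2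
      rw [hTpow]
      simpa using (hN (j + k) (by omega)).le
  refine ⟨K, r, hK, hr0, hr1, fun v hv c hc k => ?_⟩
  let u : Z := ⟨BoundedContinuousFunction.ofNormedAddCommGroup (fun k => f ((Φ ^ k) v))
    continuous_of_discreteTopology c hc, hv, v, fun _ => rfl⟩
  have hu : ‖u‖ ≤ c := BoundedContinuousFunction.norm_ofNormedAddCommGroup_le _
    ((norm_nonneg _).trans (hc 0)) hc
  calc ‖f ((Φ ^ k) v)‖ = ‖((LinearMap.toContinuousLinearMap T ^ k) u).1 0‖ := by
        rw [hTpow, zero_add]; rfl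
    _ ≤ ‖(LinearMap.toContinuousLinearMap T ^ k) u‖ := BoundedContinuousFunction.norm_coe_le_norm _ _
    _ ≤ ‖LinearMap.toContinuousLinearMap T ^ k‖ * ‖u‖ := ContinuousLinearMap.le_opNorm _ _
    _ ≤ K * r ^ k * c := by
        gcongr
        exact hb k

/-! ### The Powers–Størmer inequality -/

section PowersStormer

variable {ι : Type*} [Fintype ι] [DecidableEq ι]

theorem exists_diagonalization {A : Matrix ι ι ℂ} (hA : A.IsHermitian) :
    ∃ (U : Matrix ι ι ℂ) (x : ι → ℝ), Uᴴ * U = 1 ∧ U * Uᴴ = 1 ∧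
      A = U * diagonal (fun i => (x i : ℂ)) * Uᴴ := by
  refine ⟨hA.eigenvectorUnitary, hA.eigenvalues, ?_, ?_, ?_⟩
  · exact Unitary.coe_star_mul_self hA.eigenvectorUnitary
  · exact Unitary.coe_mul_star_self hA.eigenvectorUnitary
  · conv_lhs => rw [hA.spectral_theorem, Unitary.conjStarAlgAut_apply]
    rfl

theorem posSemidef_conj_diagonal {x : ι → ℝ} (hx : ∀ i, 0 ≤ x i) (U : Matrix ι ι ℂ) :
    (U * diagonal (fun i => (x i : ℂ)) * Uᴴ).PosSemidef := by
  refine (posSemidef_diagonal_iff.2 fun i => ?_).mul_mul_conjTranspose_same U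
  exact_mod_cast hx i

theorem exists_nonneg_diagonalization {A : Matrix ι ι ℂ} (hA : A.PosSemidef) :
    ∃ (U : Matrix ι ι ℂ) (x : ι → ℝ), Uᴴ * U = 1 ∧ U * Uᴴ = 1 ∧ (∀ i, 0 ≤ x i) ∧
      A = U * diagonal (fun i => (x i : ℂ)) * Uᴴ := by
  obtain ⟨U, x, h1, h2, h3⟩ := exists_diagonalization hA.1
  refine ⟨U, x, h1, h2, fun i => ?_, h3⟩
  have h4 : Uᴴ * A * U = diagonal (fun i => (x i : ℂ)) := by
    rw [h3]
    calc _ = (Uᴴ * U) * diagonal (fun i => (x i : ℂ)) * (Uᴴ * U) := by noncomm_ring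
      _ = _ := by rw [h1, one_mul, mul_one]
  have h5 := (hA.conjTranspose_mul_mul_same U).diag_nonneg (i := i)
  rw [h4, diagonal_apply_eq] at h5
  exact_mod_cast h5

theorem exists_posSemidef_sqrt {A : Matrix ι ι ℂ} (hA : A.PosSemidef) :
    ∃ Q : Matrix ι ι ℂ, Q.PosSemidef ∧ Q * Q = A := by
  obtain ⟨U, x, h1, -, hx, rfl⟩ := exists_nonneg_diagonalization hA
  refine ⟨U * diagonal (fun i => ((√(x i) : ℝ) : ℂ)) * Uᴴ,
    posSemidef_conj_diagonal (fun i => Real.sqrt_nonneg _) U, ?_⟩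
  calc _ = U * diagonal (fun i => ((√(x i) : ℝ) : ℂ)) * (Uᴴ * U) *
        diagonal (fun i => ((√(x i) : ℝ) : ℂ)) * Uᴴ := by noncomm_ring
    _ = _ := by
      rw [h1, mul_one, mul_assoc U, diagonal_mul_diagonal]
      congr 3
      funext i
      rw [← Complex.ofReal_mul, Real.mul_self_sqrt (hx i)]

theorem re_trace_mul_nonneg {A B : Matrix ι ι ℂ} (hA : A.PosSemidef)
    (hB : B.PosSemidef) : 0 ≤ (A * B).trace.re := by
  obtain ⟨Q, hQ, rfl⟩ := exists_posSemidef_sqrt hB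
  have := (hA.conjTranspose_mul_mul_same Q).trace_nonneg
  rw [hQ.1.eq, Matrix.mul_assoc, trace_mul_comm, Matrix.mul_assoc] at this
  exact (Complex.nonneg_iff.1 this).1

/-- The Powers–Størmer inequality `‖P - Q‖₂² ≤ ‖P² - Q²‖₁` for positive semidefinite `P`, `Q`, where
the trace norm is tested against the sign `S` of `P - Q`. -/
theorem exists_powers_stormer {P Q : Matrix ι ι ℂ} (hP : P.PosSemidef) (hQ : Q.PosSemidef) :
    ∃ S : Matrix ι ι ℂ, (1 - S).PosSemidef ∧ (1 + S).PosSemidef ∧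
      ((P - Q) * (P - Q)).trace.re ≤ (S * (P * P - Q * Q)).trace.re := by
  obtain ⟨U, x, h1, h2, h3⟩ := exists_diagonalization (hP.1.sub hQ.1)
  set s : ι → ℝ := fun i => if 0 ≤ x i then 1 else -1 with hs
  set D : Matrix ι ι ℂ := diagonal (fun i => (x i : ℂ)) with hD
  set E : Matrix ι ι ℂ := diagonal (fun i => (s i : ℂ)) with hE
  have hone : (1 : Matrix ι ι ℂ) = U * diagonal (fun i => ((1 : ℝ) : ℂ)) * Uᴴ := by
    simp [h2]
  have hs2 : ∀ i, s i = 1 ∨ s i = -1 := fun i => by simp only [hs]; split_ifs <;> simp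
  set P' := Uᴴ * P * U with hP'
  set Q' := Uᴴ * Q * U with hQ'
  have hPQ : P' - Q' = D := by
    calc P' - Q' = Uᴴ * (P - Q) * U := by simp only [hP', hQ']; noncomm_ring
      _ = (Uᴴ * U) * D * (Uᴴ * U) := by rw [h3]; noncomm_ring
      _ = D := by rw [h1, one_mul, mul_one]
  -- in the eigenbasis of `P - Q`: `P² - Q² = P (P - Q) + (P - Q) Q`
  have hcomp : Uᴴ * (P * P - Q * Q) * U = P' * D + D * Q' := by
    calc Uᴴ * (P * P - Q * Q) * U
        = Uᴴ * (P * (U * Uᴴ) * P - Q * (U * Uᴴ) * Q) * U := by rw [h2]; simp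
      _ = P' * (P' - Q') + (P' - Q') * Q' := by simp only [hP', hQ']; noncomm_ring
      _ = _ := by rw [hPQ]
  have hxi : ∀ i, (P' i i).re - (Q' i i).re = x i := fun i => by
    have := congrFun (congrFun hPQ i) i
    rw [hD, diagonal_apply_eq, Matrix.sub_apply] at this
    rw [← Complex.sub_re, this, Complex.ofReal_re]
  have hp : ∀ i, 0 ≤ (P' i i).re := fun i =>
    (Complex.nonneg_iff.1 (hP.conjTranspose_mul_mul_same U).diag_nonneg).1
  have hq : ∀ i, 0 ≤ (Q' i i).re := fun i =>
    (Complex.nonneg_iff.1 (hQ.conjTranspose_mul_mul_same U).diag_nonneg).1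
  refine ⟨U * E * Uᴴ, ?_, ?_, ?_⟩
  · have : 1 - U * E * Uᴴ = U * diagonal (fun i => ((1 - s i : ℝ) : ℂ)) * Uᴴ := by
      rw [hone, hE, ← Matrix.sub_mul, ← Matrix.mul_sub, diagonal_sub]
      simp
    rw [this]
    refine posSemidef_conj_diagonal (fun i => ?_) U
    rcases hs2 i with h | h <;> rw [h] <;> norm_num
  · have : 1 + U * E * Uᴴ = U * diagonal (fun i => ((1 + s i : ℝ) : ℂ)) * Uᴴ := by
      rw [hone, hE, ← Matrix.add_mul, ← Matrix.mul_add, diagonal_add]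
      simp
    rw [this]
    refine posSemidef_conj_diagonal (fun i => ?_) U
    rcases hs2 i with h | h <;> rw [h] <;> norm_num
  · have hl : ((P - Q) * (P - Q)).trace = (D * D).trace := by
      rw [h3]
      calc _ = (U * (D * (Uᴴ * U) * D) * Uᴴ).trace := by congr 1; noncomm_ring
        _ = _ := by rw [h1, mul_one, trace_mul_comm, ← Matrix.mul_assoc, h1, one_mul]
    have hr : (U * E * Uᴴ * (P * P - Q * Q)).trace = (E * (P' * D + D * Q')).trace := by
      rw [← hcomp, Matrix.mul_assoc, Matrix.mul_assoc, trace_mul_comm]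
      congr 1
      noncomm_ring
    rw [hl, hr, hD, hE]
    simp only [trace, diag_apply, diagonal_mul, Matrix.add_apply, mul_diagonal, diagonal_apply_eq,
      Complex.re_sum]
    refine Finset.sum_le_sum fun i _ => ?_
    rw [← Complex.ofReal_mul, Complex.ofReal_re, Complex.re_ofReal_mul, Complex.add_re,
      Complex.re_mul_ofReal, Complex.re_ofReal_mul]
    have h := hxi i
    have h1 := hp i
    have h2 := hq i
    simp only [hs]
    split_ifs with h0 <;> nlinarith

end PowersStormer

/-! ### Entropy of the reduction of a nearly factorized vector -/

theorem negMulLog_le_two_mul_sqrt {x : ℝ} (h0 : 0 ≤ x) (h1 : x ≤ 1) :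
    Real.negMulLog x ≤ 2 * √(x * (1 - x)) := by
  rcases h0.eq_or_lt with rfl | hx
  · simp
  have hs : 0 < √x := Real.sqrt_pos.2 hx
  have hs1 : √x ≤ 1 := Real.sqrt_le_one.2 h1
  have hsq : √x * √x = x := Real.mul_self_sqrt h0
  have hlog : -Real.log x ≤ 2 * ((√x)⁻¹ - 1) := by
    have h := Real.log_le_sub_one_of_pos (inv_pos.2 hs)
    rw [Real.log_inv, Real.log_sqrt h0] at h
    linarith
  have ht : 1 - √x ≤ √(1 - x) := by
    apply Real.le_sqrt_of_sq_le
    nlinarith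
  calc Real.negMulLog x = x * (-Real.log x) := by rw [Real.negMulLog]; ring
    _ ≤ x * (2 * ((√x)⁻¹ - 1)) := by gcongr
    _ = 2 * (√x * (1 - √x)) := by
        nth_rewrite 1 [← hsq]
        field_simp
    _ ≤ 2 * (√x * √(1 - x)) := by gcongr
    _ = 2 * √(x * (1 - x)) := by rw [Real.sqrt_mul h0]

section Entropy

variable {m : Type*} [Fintype m] [DecidableEq m]

theorem vonNeumannEntropy_eq_sum {R : Matrix m m ℂ} (hR : R.IsHermitian) :
    vonNeumannEntropy R = ∑ i, Real.negMulLog (hR.eigenvalues i) := by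
  rw [vonNeumannEntropy, hR.cfc_eq, Matrix.IsHermitian.cfc, Unitary.conjStarAlgAut_apply,
    trace_mul_comm, ← Matrix.mul_assoc, Unitary.coe_star_mul_self, one_mul, trace_diagonal]
  simp

theorem IsDensityMatrix.sum_eigenvalues {R : Matrix m m ℂ} (hR : IsDensityMatrix R) :
    ∑ i, hR.1.1.eigenvalues i = 1 := by
  have h : ((∑ i, hR.1.1.eigenvalues i : ℝ) : ℂ) = 1 := by
    rw [Complex.ofReal_sum]
    exact hR.1.1.trace_eq_sum_eigenvalues.symm.trans hR.2
  exact_mod_cast h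

theorem IsDensityMatrix.eigenvalues_le_one {R : Matrix m m ℂ} (hR : IsDensityMatrix R) (i : m) :
    hR.1.1.eigenvalues i ≤ 1 := by
  rw [← hR.sum_eigenvalues]
  exact Finset.single_le_sum (fun j _ => hR.1.eigenvalues_nonneg j) (Finset.mem_univ i)

theorem IsDensityMatrix.vonNeumannEntropy_nonneg {R : Matrix m m ℂ} (hR : IsDensityMatrix R) :
    0 ≤ vonNeumannEntropy R := by
  rw [vonNeumannEntropy_eq_sum hR.1.1]
  exact Finset.sum_nonneg fun i _ =>
    Real.negMulLog_nonneg (hR.1.eigenvalues_nonneg i) (hR.eigenvalues_le_one i)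

theorem sum_norm_sq_eq_re {m : Type*} [Fintype m] (v : m → ℂ) : ∑ i, ‖v i‖ ^ 2 = (star v ⬝ᵥ v).re := by
  simp only [dotProduct, Complex.re_sum, Pi.star_apply]
  refine Finset.sum_congr rfl fun i _ => ?_
  rw [← Complex.normSq_eq_norm_sq, Complex.normSq_apply]
  simp

/-- A density matrix with expectation `f` in some unit vector has entropy `O(√(1 - f))`: its
linear entropy `1 - Tr R²` is at most `1 - f²`. -/
theorem IsDensityMatrix.vonNeumannEntropy_le {R : Matrix m m ℂ} (hR : IsDensityMatrix R)
    {u : m → ℂ} (hu : ∑ a, ‖u a‖ ^ 2 = 1) :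
    vonNeumannEntropy R ≤
      2 * √(2 * Fintype.card m * (1 - (star u ⬝ᵥ R *ᵥ u).re)) := by
  rw [vonNeumannEntropy_eq_sum hR.1.1]
  set U : Matrix m m ℂ := (hR.1.1.eigenvectorUnitary).1 with hU
  set x := hR.1.1.eigenvalues with hx
  have hU1 : U * Uᴴ = 1 := Unitary.coe_mul_star_self hR.1.1.eigenvectorUnitary
  have hsp : R = U * diagonal (fun i => (x i : ℂ)) * Uᴴ := by
    conv_lhs => rw [hR.1.1.spectral_theorem, Unitary.conjStarAlgAut_apply]
    rfl
  have hx0 : ∀ i, 0 ≤ x i := hR.1.eigenvalues_nonneg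
  have hx1 : ∀ i, x i ≤ 1 := hR.eigenvalues_le_one
  have hxs : ∑ i, x i = 1 := hR.sum_eigenvalues
  set w : m → ℂ := Uᴴ *ᵥ u with hw
  have hwsum : ∑ i, ‖w i‖ ^ 2 = 1 := by
    rw [sum_norm_sq_eq_re, hw, star_mulVec, conjTranspose_conjTranspose, dotProduct_mulVec,
      vecMul_vecMul, hU1, vecMul_one, ← sum_norm_sq_eq_re, hu]
  have hf : (star u ⬝ᵥ R *ᵥ u).re = ∑ i, ‖w i‖ ^ 2 * x i := by
    have h1 : star u ⬝ᵥ R *ᵥ u = star w ⬝ᵥ diagonal (fun i => (x i : ℂ)) *ᵥ w := by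
      rw [hw, star_mulVec, conjTranspose_conjTranspose, hsp]
      simp only [dotProduct_mulVec, vecMul_vecMul, Matrix.mul_assoc]
    rw [h1]
    simp only [dotProduct, mulVec_diagonal, Complex.re_sum, Pi.star_apply]
    refine Finset.sum_congr rfl fun i _ => ?_
    rw [← Complex.normSq_eq_norm_sq, Complex.normSq_apply]
    simp
    ring
  set f := (star u ⬝ᵥ R *ᵥ u).re with hfdef
  have hfsq : f ^ 2 ≤ ∑ i, x i ^ 2 := by
    rw [hf]
    refine (Real.pow_arith_mean_le_arith_mean_pow Finset.univ (fun i => ‖w i‖ ^ 2) x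
      (fun i _ => by positivity) hwsum (fun i _ => hx0 i) 2).trans ?_
    refine Finset.sum_le_sum fun i hi => mul_le_of_le_one_left (by positivity) ?_
    rw [← hwsum]
    exact Finset.single_le_sum (f := fun i => ‖w i‖ ^ 2) (fun j _ => by positivity) hi
  have hlin : ∑ i, x i * (1 - x i) ≤ 2 * (1 - f) := by
    have : ∑ i, x i * (1 - x i) = 1 - ∑ i, x i ^ 2 := by
      simp only [mul_sub, mul_one, Finset.sum_sub_distrib, hxs, sq]
    rw [this]
    nlinarith [sq_nonneg (1 - f)]
  calc ∑ i, Real.negMulLog (x i) ≤ ∑ i, 2 * √(x i * (1 - x i)) :=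
        Finset.sum_le_sum fun i _ => negMulLog_le_two_mul_sqrt (hx0 i) (hx1 i)
    _ = 2 * ∑ i, √(x i * (1 - x i)) := by rw [Finset.mul_sum]
    _ ≤ 2 * √(Fintype.card m * ∑ i, x i * (1 - x i)) := by
        gcongr
        apply Real.le_sqrt_of_sq_le
        refine (sq_sum_le_card_mul_sum_sq).trans ?_
        rw [Finset.card_univ]
        gcongr with i
        exact (Real.sq_sqrt (mul_nonneg (hx0 i) (sub_nonneg.2 (hx1 i)))).le
    _ ≤ _ := by
        gcongr 2 * √?_
        calc _ ≤ (Fintype.card m : ℝ) * (2 * (1 - f)) := by gcongr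
          _ = _ := by ring

end Entropy

/-! ### Entanglement of formation near a product state -/

section EntanglementOfFormation

variable {m n : Type*} [Fintype m] [Fintype n]

theorem partialTraceRight_ketBra {m n : Type*} [Fintype n] (ψ : m × n → ℂ) :
    partialTraceRight (ketBra ψ) =
      (of fun a b => ψ (a, b)) * (of fun a b => ψ (a, b) : Matrix m n ℂ)ᴴ := by
  ext a a'
  simp [partialTraceRight, ketBra, vecMulVec_apply, mul_apply]

theorem isDensityMatrix_partialTraceRight_ketBra {ψ : m × n → ℂ} (hψ : ∑ a, ‖ψ a‖ ^ 2 = 1) :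
    IsDensityMatrix (partialTraceRight (ketBra ψ)) := by
  constructor
  · rw [partialTraceRight_ketBra]
    exact posSemidef_self_mul_conjTranspose _
  · have h : (partialTraceRight (ketBra ψ)).trace = ((∑ a, ‖ψ a‖ ^ 2 : ℝ) : ℂ) := by
      simp only [trace, diag_apply, partialTraceRight, ketBra, of_apply, vecMulVec_apply,
        Fintype.sum_prod_type, Complex.ofReal_sum, Pi.star_apply]
      refine Finset.sum_congr rfl fun a _ => Finset.sum_congr rfl fun b _ => ?_
      simpa using Complex.mul_conj' (ψ (a, b))
    rw [h, hψ, Complex.ofReal_one]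

theorem norm_dotProduct_sq_le (v w : n → ℂ) :
    ‖v ⬝ᵥ w‖ ^ 2 ≤ (∑ b, ‖v b‖ ^ 2) * ∑ b, ‖w b‖ ^ 2 := by
  refine le_trans ?_ (Finset.sum_mul_sq_le_sq_mul_sq Finset.univ (fun b => ‖v b‖) fun b => ‖w b‖)
  gcongr
  exact (norm_sum_le _ _).trans (Finset.sum_le_sum fun b _ => (norm_mul _ _).le)

/-- The fidelity of `ψ` with a product vector `u ⊗ v` is at most the expectation in `u` of the
reduction of `ψ`. -/
theorem norm_overlap_sq_le (ψ : m × n → ℂ) (u : m → ℂ) {v : n → ℂ} (hv : ∑ b, ‖v b‖ ^ 2 = 1) :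
    ‖star (fun c : m × n => u c.1 * v c.2) ⬝ᵥ ψ‖ ^ 2 ≤
      (star u ⬝ᵥ partialTraceRight (ketBra ψ) *ᵥ u).re := by
  rw [partialTraceRight_ketBra]
  set Ψ : Matrix m n ℂ := of fun a b => ψ (a, b)
  have h1 : (star u ⬝ᵥ (Ψ * Ψᴴ) *ᵥ u).re = ∑ b, ‖(star u ᵥ* Ψ) b‖ ^ 2 := by
    have : star u ⬝ᵥ (Ψ * Ψᴴ) *ᵥ u = star (Ψᴴ *ᵥ u) ⬝ᵥ (Ψᴴ *ᵥ u) := by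
      rw [star_mulVec, conjTranspose_conjTranspose, ← dotProduct_mulVec, mulVec_mulVec]
    rw [this, ← sum_norm_sq_eq_re]
    refine Finset.sum_congr rfl fun b _ => ?_
    rw [← norm_star (((star u) ᵥ* Ψ) b), ← Pi.star_apply, star_vecMul, star_star]
  have h2 : star (fun c : m × n => u c.1 * v c.2) ⬝ᵥ ψ = star v ⬝ᵥ (star u ᵥ* Ψ) := by
    simp only [dotProduct, vecMul, Fintype.sum_prod_type_right, Finset.mul_sum, Pi.star_apply]
    refine Finset.sum_congr rfl fun b _ => Finset.sum_congr rfl fun a _ => ?_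
    simp only [star_mul', Ψ, of_apply]
    ring
  rw [h1, h2]
  refine (norm_dotProduct_sq_le _ _).trans ?_
  simp [hv]

variable [DecidableEq m]

theorem bddBelow_averageEntropy (σ : Matrix (m × n) (m × n) ℂ) :
    BddBelow {e : ℝ | ∃ (k : ℕ) (p : Fin k → ℝ) (ψ : Fin k → m × n → ℂ),
      IsPureDecomposition σ p ψ ∧
        e = ∑ i, p i * vonNeumannEntropy (partialTraceRight (ketBra (ψ i)))} := by
  refine ⟨0, ?_⟩
  rintro e ⟨k, p, ψ, h, rfl⟩
  exact Finset.sum_nonneg fun i _ => mul_nonneg (h.nonneg i)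
    (isDensityMatrix_partialTraceRight_ketBra (h.normalized i)).vonNeumannEntropy_nonneg

/-- With a first factor of dimension at most one, all reductions have entropy zero. -/
theorem entanglementOfFormation_nonpos_of_subsingleton [Subsingleton m]
    (σ : Matrix (m × n) (m × n) ℂ) : entanglementOfFormation σ ≤ 0 := by
  refine Real.sInf_nonpos ?_
  rintro e ⟨k, p, ψ, h, rfl⟩
  refine Finset.sum_nonpos fun i _ => mul_nonpos_of_nonneg_of_nonpos (h.nonneg i) ?_
  have hR := isDensityMatrix_partialTraceRight_ketBra (h.normalized i)
  rw [vonNeumannEntropy_eq_sum hR.1.1]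
  refine Finset.sum_nonpos fun j _ => ?_
  have hj : hR.1.1.eigenvalues j = 1 := by
    rw [← hR.sum_eigenvalues]
    exact (Fintype.sum_subsingleton _ j).symm
  rw [hj, Real.negMulLog_one]

/-- A decomposition of `σ` into (unnormalized) vectors `φ j` at mean square distance `δ` from the lines
spanned by product vectors `u j ⊗ v j` bounds the entanglement of formation by `O(√δ)`. -/
theorem entanglementOfFormation_le_of_family {ι : Type*} [Fintype ι]
    {σ : Matrix (m × n) (m × n) ℂ} {φ : ι → m × n → ℂ} (hφ : σ = ∑ j, ketBra (φ j))
    (hsum : ∑ j, ∑ c, ‖φ j c‖ ^ 2 = 1) {u : ι → m → ℂ} {v : ι → n → ℂ}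
    (hu : ∀ j, ∑ a, ‖u j a‖ ^ 2 = 1) (hv : ∀ j, ∑ b, ‖v j b‖ ^ 2 = 1) {δ : ℝ}
    (hδ : ∑ j, (∑ c, ‖φ j c‖ ^ 2 -
      ‖star (fun c : m × n => u j c.1 * v j c.2) ⬝ᵥ φ j‖ ^ 2) ≤ δ) :
    entanglementOfFormation σ ≤ 2 * √(2 * Fintype.card m * δ) := by
  classical
  set p : ι → ℝ := fun j => ∑ c, ‖φ j c‖ ^ 2 with hp
  set e : ι → m × n → ℂ := fun j c => u j c.1 * v j c.2 with he
  have hp0 : ∀ j, 0 ≤ p j := fun j => Finset.sum_nonneg fun _ _ => by positivity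
  -- a vector of weight zero is replaced by an arbitrary unit vector, here the product vector
  set ψ : ι → m × n → ℂ := fun j => if p j = 0 then e j else ((√(p j))⁻¹ : ℂ) • φ j with hψ
  have hφψ : ∀ j, φ j = (√(p j) : ℂ) • ψ j := by
    intro j
    by_cases h : p j = 0
    · have h0 : φ j = 0 := by
        funext c
        have := (Finset.sum_eq_zero_iff_of_nonneg (fun c _ => by positivity)).1 h c
          (Finset.mem_univ c)
        simpa using this
      rw [h, h0]; simp
    · have : (√(p j) : ℂ) ≠ 0 := by
        exact_mod_cast (Real.sqrt_ne_zero'.2 (lt_of_le_of_ne (hp0 j) (Ne.symm h)))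
      simp only [hψ, if_neg h]
      rw [smul_smul, mul_inv_cancel₀ this, one_smul]
  have hψ1 : ∀ j, ∑ c, ‖ψ j c‖ ^ 2 = 1 := by
    intro j
    by_cases h : p j = 0
    · simp only [hψ, if_pos h, he, norm_mul, mul_pow, Fintype.sum_prod_type]
      simp only [← Finset.mul_sum, hv, mul_one, hu]
    · have h1 : p j = p j * ∑ c, ‖ψ j c‖ ^ 2 := by
        conv_lhs => rw [hp]
        simp only
        rw [hφψ j, Finset.mul_sum]
        refine Finset.sum_congr rfl fun c _ => ?_
        rw [Pi.smul_apply, norm_smul, mul_pow, Complex.norm_real, Real.norm_eq_abs, sq_abs,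
          Real.sq_sqrt (hp0 j)]
      exact (mul_right_eq_self₀.1 h1.symm).resolve_right h
  have hterm : ∀ j, p j * vonNeumannEntropy (partialTraceRight (ketBra (ψ j))) ≤
      p j * (2 * √(2 * Fintype.card m * (1 - ‖star (e j) ⬝ᵥ ψ j‖ ^ 2))) := by
    intro j
    refine mul_le_mul_of_nonneg_left ?_ (hp0 j)
    refine ((isDensityMatrix_partialTraceRight_ketBra (hψ1 j)).vonNeumannEntropy_le (hu j)).trans ?_
    gcongr
    exact norm_overlap_sq_le (ψ j) (u j) (hv j)
  have hq0 : ∀ j, 0 ≤ 1 - ‖star (e j) ⬝ᵥ ψ j‖ ^ 2 := by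
    intro j
    rw [sub_nonneg]
    refine (norm_dotProduct_sq_le _ _).trans ?_
    rw [hψ1 j, mul_one]
    simp only [he, Pi.star_apply, norm_star, norm_mul, mul_pow, Fintype.sum_prod_type]
    simp only [← Finset.mul_sum, hv, mul_one, hu, le_refl]
  have hpq : ∀ j, p j * (1 - ‖star (e j) ⬝ᵥ ψ j‖ ^ 2) =
      ∑ c, ‖φ j c‖ ^ 2 - ‖star (e j) ⬝ᵥ φ j‖ ^ 2 := by
    intro j
    conv_rhs => rw [hφψ j, dotProduct_smul, norm_smul, mul_pow, Complex.norm_real,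
      Real.norm_eq_abs, sq_abs, Real.sq_sqrt (hp0 j), ← hφψ j]
    rw [mul_sub, mul_one]
  have havg : ∑ j, p j * vonNeumannEntropy (partialTraceRight (ketBra (ψ j))) ≤
      2 * √(2 * Fintype.card m * δ) := by
    calc _ ≤ ∑ j, p j * (2 * √(2 * Fintype.card m * (1 - ‖star (e j) ⬝ᵥ ψ j‖ ^ 2))) :=
          Finset.sum_le_sum fun j _ => hterm j
      _ = 2 * ∑ j, p j * √(2 * Fintype.card m * (1 - ‖star (e j) ⬝ᵥ ψ j‖ ^ 2)) := by
          rw [Finset.mul_sum]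
          exact Finset.sum_congr rfl fun j _ => by ring
      _ ≤ 2 * √(2 * Fintype.card m * δ) := by
          gcongr
          apply Real.le_sqrt_of_sq_le
          refine (Real.pow_arith_mean_le_arith_mean_pow Finset.univ p _ (fun j _ => hp0 j) hsum
            (fun j _ => Real.sqrt_nonneg _) 2).trans ?_
          calc _ = 2 * (Fintype.card m : ℝ) * ∑ j, p j * (1 - ‖star (e j) ⬝ᵥ ψ j‖ ^ 2) := by
                rw [Finset.mul_sum]
                refine Finset.sum_congr rfl fun j _ => ?_
                rw [Real.sq_sqrt (mul_nonneg (by positivity) (hq0 j))]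
                ring
            _ ≤ _ := by
                gcongr
                simp only [hpq]
                exact hδ
  refine le_trans (csInf_le (bddBelow_averageEntropy σ) ?_) havg
  let t := (Fintype.equivFin ι).symm
  refine ⟨Fintype.card ι, fun i => p (t i), fun i => ψ (t i), ⟨fun i => hp0 _, ?_, fun i => hψ1 _,
    ?_⟩, ?_⟩
  · rw [t.sum_comp p, hsum]
  · rw [t.sum_comp fun j => (p j : ℂ) • ketBra (ψ j), hφ]
    refine Finset.sum_congr rfl fun j _ => ?_
    conv_lhs => rw [hφψ j]
    simp only [ketBra, star_smul, smul_vecMulVec, vecMulVec_smul, smul_smul]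
    congr 1
    rw [Complex.star_def, Complex.conj_ofReal, ← Complex.ofReal_mul, Real.mul_self_sqrt (hp0 j)]
  · rw [t.sum_comp fun j => p j * vonNeumannEntropy (partialTraceRight (ketBra (ψ j)))]

variable [DecidableEq n]

/-- A state close in trace norm to a product state has small entanglement of formation: decompose
`σ` into the vectors `√σ e`, with `e` running through a product eigenbasis of `α ⊗ β`. These are
close to the product vectors `√(α ⊗ β) e` by the Powers–Størmer inequality. -/
theorem entanglementOfFormation_le_of_near_product {σ : Matrix (m × n) (m × n) ℂ}
    (hσ : IsDensityMatrix σ) {α : Matrix m m ℂ} {β : Matrix n n ℂ} (hα : α.PosSemidef)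
    (hβ : β.PosSemidef) {δ : ℝ}
    (hδ : ∀ S : Matrix (m × n) (m × n) ℂ, (1 - S).PosSemidef → (1 + S).PosSemidef →
      (S * (σ - α ⊗ₖ β)).trace.re ≤ δ) :
    entanglementOfFormation σ ≤ 2 * √(2 * Fintype.card m * δ) := by
  obtain ⟨U, x, hU1, hU2, hx, hαU⟩ := exists_nonneg_diagonalization hα
  obtain ⟨V, y, hV1, hV2, hy, hβV⟩ := exists_nonneg_diagonalization hβ
  obtain ⟨Q, hQ, hQσ⟩ := exists_posSemidef_sqrt hσ.1
  set W : Matrix (m × n) (m × n) ℂ := U ⊗ₖ V with hW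
  have hWH : Wᴴ = Uᴴ ⊗ₖ Vᴴ := conjTranspose_kronecker U V
  have hW1 : Wᴴ * W = 1 := by
    rw [hWH, hW, ← mul_kronecker_mul, hU1, hV1, one_kronecker_one]
  have hW2 : W * Wᴴ = 1 := by
    rw [hWH, hW, ← mul_kronecker_mul, hU2, hV2, one_kronecker_one]
  set t : m × n → ℝ := fun c => √(x c.1 * y c.2) with ht
  set D : Matrix (m × n) (m × n) ℂ := diagonal fun c => (t c : ℂ) with hD
  have hT2 : (W * D * Wᴴ) * (W * D * Wᴴ) = α ⊗ₖ β := by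
    calc _ = W * D * (Wᴴ * W) * D * Wᴴ := by noncomm_ring
      _ = W * (D * D) * Wᴴ := by rw [hW1, mul_one]; noncomm_ring
      _ = α ⊗ₖ β := by
        rw [hαU, hβV, mul_kronecker_mul, mul_kronecker_mul, ← hWH, ← hW, hD,
          diagonal_mul_diagonal, diagonal_kronecker_diagonal]
        congr 3
        funext c
        rw [← Complex.ofReal_mul, ← Complex.ofReal_mul,
          Real.mul_self_sqrt (mul_nonneg (hx _) (hy _))]
  obtain ⟨S, hS1, hS2, hS⟩ := exists_powers_stormer hQ
    (posSemidef_conj_diagonal (fun c => Real.sqrt_nonneg (x c.1 * y c.2)) W)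
  have hS' := hS.trans (by
    change (S * (Q * Q - (W * D * Wᴴ) * (W * D * Wᴴ))).trace.re ≤ δ
    rw [hT2, hQσ]
    exact hδ S hS1 hS2)
  set Q' := Wᴴ * Q * W with hQ'
  have hQ'h : Q'.IsHermitian := (hQ.conjTranspose_mul_mul_same W).1
  have hcol : ∀ (M : Matrix (m × n) (m × n) ℂ) j, ∑ c, ‖M c j‖ ^ 2 = ((Mᴴ * M) j j).re := by
    intro M j
    rw [sum_norm_sq_eq_re (fun c => M c j)]
    rfl
  have hUcol : ∀ j, ∑ a, ‖U a j‖ ^ 2 = 1 := fun j => by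
    have h : (star (fun a => U a j) ⬝ᵥ fun a => U a j) = (Uᴴ * U) j j := rfl
    rw [sum_norm_sq_eq_re (fun a => U a j), h, hU1, one_apply_eq, Complex.one_re]
  have hVcol : ∀ j, ∑ a, ‖V a j‖ ^ 2 = 1 := fun j => by
    have h : (star (fun a => V a j) ⬝ᵥ fun a => V a j) = (Vᴴ * V) j j := rfl
    rw [sum_norm_sq_eq_re (fun a => V a j), h, hV1, one_apply_eq, Complex.one_re]
  have hnorm : ∀ j, ∑ c, ‖(Q * W) c j‖ ^ 2 = ((Q' * Q') j j).re := by
    intro j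
    rw [hcol, conjTranspose_mul, hQ.1.eq]
    have : Wᴴ * Q * (Q * W) = Q' * Q' := by
      calc _ = Wᴴ * Q * 1 * Q * W := by noncomm_ring
        _ = _ := by rw [← hW2, hQ']; noncomm_ring
    rw [this]
  have hQQ : (Q' * Q').trace = 1 := by
    rw [← hσ.2, ← hQσ]
    calc _ = (Wᴴ * (Q * (W * Wᴴ) * (Q * W))).trace := by rw [hQ']; congr 1; noncomm_ring
      _ = _ := by
        rw [hW2, mul_one, trace_mul_comm]
        congr 1
        calc _ = Q * Q * (W * Wᴴ) := by noncomm_ring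
          _ = _ := by rw [hW2, mul_one]
  refine entanglementOfFormation_le_of_family (φ := fun j c => (Q * W) c j)
    (u := fun j a => U a j.1) (v := fun j b => V b j.2) ?_ ?_ (fun j => hUcol j.1)
    (fun j => hVcol j.2) ?_
  · have : σ = (Q * W) * (Q * W)ᴴ := by
      rw [conjTranspose_mul, hQ.1.eq, ← hQσ]
      calc Q * Q = Q * 1 * Q := by rw [mul_one]
        _ = _ := by rw [← hW2]; noncomm_ring
    conv_lhs => rw [this]
    ext c c'
    simp only [mul_apply (M := Q * W), ketBra, vecMulVec_apply, Matrix.sum_apply,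
      conjTranspose_apply, Pi.star_apply]
  · simp only [hnorm]
    rw [← Complex.re_sum]
    change ((Q' * Q').trace).re = 1
    rw [hQQ, Complex.one_re]
  · refine le_trans ?_ hS'
    have htr : ((Q - W * D * Wᴴ) * (Q - W * D * Wᴴ)).trace = ((Q' - D) * (Q' - D)).trace := by
      have h : Q - W * D * Wᴴ = W * (Q' - D) * Wᴴ := by
        calc _ = (W * Wᴴ) * Q * (W * Wᴴ) - W * D * Wᴴ := by rw [hW2, one_mul, mul_one]
          _ = _ := by rw [hQ']; noncomm_ring
      rw [h]
      calc _ = (W * ((Q' - D) * (Wᴴ * W) * (Q' - D)) * Wᴴ).trace := by congr 1; noncomm_ring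
        _ = _ := by rw [hW1, mul_one, trace_mul_comm, ← Matrix.mul_assoc, hW1, one_mul]
    change _ ≤ ((Q - W * D * Wᴴ) * (Q - W * D * Wᴴ)).trace.re
    rw [htr, trace, Complex.re_sum]
    refine Finset.sum_le_sum fun j _ => ?_
    have hov : (star (fun c : m × n => U c.1 j.1 * V c.2 j.2) ⬝ᵥ fun c => (Q * W) c j) =
        Q' j j := by
      rw [hQ', Matrix.mul_assoc]
      rfl
    have him : (Q' j j).im = 0 := by
      have := hQ'h.apply j j
      rwa [Complex.star_def, Complex.conj_eq_iff_im] at this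
    have hnq : ‖Q' j j‖ ^ 2 = (Q' j j).re ^ 2 := by
      rw [← Complex.normSq_eq_norm_sq, Complex.normSq_apply, him]
      ring
    have hexp : (((Q' - D) * (Q' - D)) j j).re =
        ((Q' * Q') j j).re - 2 * t j * (Q' j j).re + t j ^ 2 := by
      rw [Matrix.sub_mul, Matrix.mul_sub, Matrix.mul_sub, hD]
      simp only [Matrix.sub_apply, mul_diagonal, diagonal_mul, diagonal_apply_eq, Complex.sub_re,
        Complex.re_mul_ofReal, Complex.re_ofReal_mul, Complex.ofReal_re]
      ring
    rw [hnorm, hov, hnq, diag_apply, hexp]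
    nlinarith [sq_nonneg ((Q' j j).re - t j)]

end EntanglementOfFormation

/-! ### Positive semidefinite matrices: entry bound, limits -/

section PosSemidef

variable {X : Type*} [Fintype X]

/-- The entries are bounded by the diagonal ones, since `2 × 2` principal minors are nonnegative. -/
theorem IsDensityMatrix.norm_apply_le_one {M : Matrix X X ℂ} (hM : IsDensityMatrix M) (x y : X) :
    ‖M x y‖ ≤ 1 := by
  have hdiag : ∀ z, 0 ≤ (M z z).re ∧ (M z z).im = 0 := fun z => by
    have := Complex.nonneg_iff.1 (hM.1.diag_nonneg (i := z))
    exact ⟨this.1, this.2.symm⟩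
  have hle : ∀ z, (M z z).re ≤ 1 := fun z => by
    have h : ∑ z, (M z z).re = 1 := by
      rw [← Complex.re_sum]
      exact (congrArg Complex.re hM.2).trans Complex.one_re
    rw [← h]
    exact Finset.single_le_sum (f := fun z => (M z z).re) (fun w _ => (hdiag w).1)
      (Finset.mem_univ z)
  have hdet := (hM.1.submatrix ![x, y]).det_nonneg
  rw [det_fin_two] at hdet
  simp only [submatrix_apply, cons_val_zero, cons_val_one] at hdet
  have hre := (Complex.nonneg_iff.1 hdet).1
  have hyx : M y x = star (M x y) := (hM.1.1.apply y x).symm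
  have hn : (M x y * M y x).re = ‖M x y‖ ^ 2 := by
    rw [hyx, ← Complex.normSq_eq_norm_sq, Complex.normSq_apply, Complex.star_def]
    simp
  rw [Complex.sub_re, hn, Complex.mul_re, (hdiag x).2, zero_mul, sub_zero] at hre
  nlinarith [norm_nonneg (M x y), hdiag x, hdiag y, hle x, hle y]

theorem posSemidef_of_tendsto {κ : Type*} {l : Filter κ} [l.NeBot] {F : κ → Matrix X X ℂ}
    {L : Matrix X X ℂ} (hF : Tendsto F l (𝓝 L)) (hpos : ∀ᶠ k in l, (F k).PosSemidef) :
    L.PosSemidef := by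
  rw [posSemidef_iff_dotProduct_mulVec]
  constructor
  · refine tendsto_nhds_unique_of_eventuallyEq ?_ hF (hpos.mono fun k hk => hk.1)
    exact (continuous_id.matrix_conjTranspose.tendsto L).comp hF
  · intro v
    have hc : Continuous fun M : Matrix X X ℂ => star v ⬝ᵥ M *ᵥ v := by fun_prop
    exact ge_of_tendsto ((hc.tendsto L).comp hF) (hpos.mono fun k hk => hk.dotProduct_mulVec_nonneg v)

theorem exists_tendsto_of_norm_apply_le {X : Type*} (U : Ultrafilter ℕ) (F : ℕ → Matrix X X ℂ) (C : ℝ)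
    (hF : ∀ k x y, ‖F k x y‖ ≤ C) : ∃ L, Tendsto F U (𝓝 L) := by
  have hc : IsCompact {M : Matrix X X ℂ | ∀ x, M x ∈ {v : X → ℂ | ∀ y, v y ∈ Metric.closedBall 0 C}} :=
    isCompact_pi_infinite fun _ => isCompact_pi_infinite fun _ => isCompact_closedBall _ _
  obtain ⟨L, -, hL⟩ := hc.ultrafilter_le_nhds (U.map F) (by
    rw [le_principal_iff, Ultrafilter.coe_map, mem_map]
    exact Filter.Eventually.of_forall fun k x y => by simpa using hF k x y)
  exact ⟨L, hL⟩

variable [DecidableEq X]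

theorem exists_bound_of_isHermitian {A : Matrix X X ℂ} (hA : A.IsHermitian) :
    ∃ t : ℝ, 0 < t ∧ ((t : ℂ) • 1 - A).PosSemidef ∧ ((t : ℂ) • 1 + A).PosSemidef := by
  obtain ⟨U, x, -, h2, h3⟩ := exists_diagonalization hA
  have hone : ∀ t : ℝ, (t : ℂ) • (1 : Matrix X X ℂ) = U * diagonal (fun _ => (t : ℂ)) * Uᴴ := by
    intro t
    rw [← smul_one_eq_diagonal, Matrix.mul_smul, mul_one, Matrix.smul_mul, h2]
  have hle : ∀ i, |x i| ≤ ∑ j, |x j| + 1 := fun i =>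
    (Finset.single_le_sum (f := fun j => |x j|) (fun j _ => abs_nonneg _)
      (Finset.mem_univ i)).trans (by linarith)
  refine ⟨∑ j, |x j| + 1, add_pos_of_nonneg_of_pos (Finset.sum_nonneg fun _ _ => abs_nonneg _)
    one_pos, ?_, ?_⟩
  · rw [hone, h3, ← Matrix.sub_mul, ← Matrix.mul_sub, diagonal_sub]
    have := posSemidef_conj_diagonal (x := fun i => (∑ j, |x j| + 1) - x i)
      (fun i => by linarith [hle i, le_abs_self (x i)]) U
    simpa using this
  · rw [hone, h3, ← Matrix.add_mul, ← Matrix.mul_add, diagonal_add]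
    have := posSemidef_conj_diagonal (x := fun i => (∑ j, |x j| + 1) + x i)
      (fun i => by linarith [hle i, neg_abs_le (x i)]) U
    simpa using this

end PosSemidef

/-! ### One spin together with a region -/

section Slice

variable {m X : Type*} [Fintype m]

/-- The functional `Tr (A ·)` applied to the first factor of a bipartite matrix. -/
def slice (A : Matrix m m ℂ) (M : Matrix (m × X) (m × X) ℂ) : Matrix X X ℂ :=
  of fun x y => ∑ a, ∑ a', A a' a * M (a, x) (a', y)

theorem slice_add (A B : Matrix m m ℂ) (M : Matrix (m × X) (m × X) ℂ) :
    slice (A + B) M = slice A M + slice B M := by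
  ext x y
  simp [slice, add_mul, Finset.sum_add_distrib]

theorem slice_smul (c : ℂ) (A : Matrix m m ℂ) (M : Matrix (m × X) (m × X) ℂ) :
    slice (c • A) M = c • slice A M := by
  ext x y
  simp [slice, Finset.mul_sum, mul_assoc]

theorem trace_slice [Fintype X] (A : Matrix m m ℂ) (M : Matrix (m × X) (m × X) ℂ) :
    (slice A M).trace = (A * partialTraceRight M).trace := by
  simp only [trace, diag_apply, slice, of_apply, mul_apply, partialTraceRight, Finset.mul_sum]
  rw [Finset.sum_congr rfl fun x _ => Finset.sum_comm, Finset.sum_comm]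
  exact Finset.sum_congr rfl fun a' _ => Finset.sum_comm

theorem slice_one [DecidableEq m] (M : Matrix (m × X) (m × X) ℂ) :
    slice 1 M = of fun x y => ∑ a, M (a, x) (a, y) := by
  ext x y
  simp [slice, one_apply]

theorem slice_single [DecidableEq m] (M : Matrix (m × X) (m × X) ℂ) (a a' : m) (x y : X) :
    slice (single a' a 1) M x y = M (a, x) (a', y) := by
  simp [slice, single_apply, ite_and, Finset.sum_ite_eq]

theorem posSemidef_slice [Fintype X] {A : Matrix m m ℂ}
    {M : Matrix (m × X) (m × X) ℂ} (hA : A.PosSemidef) (hM : M.PosSemidef) :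
    (slice A M).PosSemidef := by
  classical
  obtain ⟨Q, hQ, rfl⟩ := exists_posSemidef_sqrt hA
  have h : slice (Q * Q) M = ∑ c, ((Q ⊗ₖ (1 : Matrix X X ℂ)) * M *
      (Q ⊗ₖ (1 : Matrix X X ℂ))ᴴ).submatrix (fun x => (c, x)) (fun x => (c, x)) := by
    ext x y
    rw [conjTranspose_kronecker, hQ.1.eq, conjTranspose_one, Matrix.sum_apply]
    simp only [slice, of_apply, mul_apply, submatrix_apply, kronecker_apply, Fintype.sum_prod_type,
      one_apply, mul_ite, ite_mul, mul_one, mul_zero, zero_mul, Finset.sum_ite_eq,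
      Finset.mem_univ, if_true, Finset.sum_mul]
    rw [Finset.sum_congr rfl fun a _ => Finset.sum_comm, Finset.sum_comm]
    refine Finset.sum_congr rfl fun c _ => ?_
    rw [Finset.sum_comm]
    refine Finset.sum_congr rfl fun a' _ => ?_
    conv_rhs => rw [Finset.sum_comm]
    simp only [Finset.sum_ite_eq', Finset.mem_univ, if_true]
    exact Finset.sum_congr rfl fun a _ => by ring
  rw [h]
  exact posSemidef_sum _ fun c _ => (hM.mul_mul_conjTranspose_same _).submatrix _

end Slice

namespace ChainState

variable {d : ℕ} (ω : ChainState d)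

theorem rho_congr {Λ Λ' : Finset ℤ} (h : Λ = Λ') (x y : Λ → Fin d) :
    ω.rho Λ x y = ω.rho Λ' (fun j => x ⟨j, h ▸ j.2⟩) (fun j => y ⟨j, h ▸ j.2⟩) := by
  subst h
  rfl

/-- The configuration of `insert i Λ` with value `s.1` at `i` and `s.2` on `Λ`. -/
def join (i : ℤ) (Λ : Finset ℤ) (s : Fin d × (Λ → Fin d)) : ↥(insert i Λ) → Fin d :=
  fun j => if h : (j : ℤ) ∈ Λ then s.2 ⟨j, h⟩ else s.1

theorem siteRegion_apply (i : ℤ) (Λ : Finset ℤ) (s t : Fin d × (Λ → Fin d)) :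
    ω.siteRegion i Λ s t = ω.rho (insert i Λ) (join i Λ s) (join i Λ t) := rfl

theorem join_bijective {i : ℤ} {Λ : Finset ℤ} (hi : i ∉ Λ) :
    Function.Bijective (join (d := d) i Λ) := by
  refine Function.bijective_iff_has_inverse.2 ⟨fun x => (x ⟨i, Finset.mem_insert_self _ _⟩,
    fun j => x ⟨j, Finset.mem_insert_of_mem j.2⟩), fun s => ?_, fun x => ?_⟩
  · ext j <;> simp [join, hi]
  · funext j
    by_cases hj : (j : ℤ) ∈ Λ
    · simp [join, hj]
    · have : j = ⟨i, Finset.mem_insert_self _ _⟩ :=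
        Subtype.ext ((Finset.mem_insert.1 j.2).resolve_right hj)
      subst this
      simp [join, hi]

theorem posSemidef_siteRegion (i : ℤ) (Λ : Finset ℤ) : (ω.siteRegion i Λ).PosSemidef :=
  (ω.isDensity _).1.submatrix _

theorem isDensityMatrix_siteRegion {i : ℤ} {Λ : Finset ℤ} (hi : i ∉ Λ) :
    IsDensityMatrix (ω.siteRegion i Λ) := by
  refine ⟨ω.posSemidef_siteRegion i Λ, ?_⟩
  rw [← (ω.isDensity (insert i Λ)).2]
  exact Fintype.sum_bijective _ (join_bijective hi) _ _ fun s => rfl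

theorem siteRegion_eq_sum {i : ℤ} {Λ Λ' : Finset ℤ} (hΛ : Λ ⊆ Λ') (hi : i ∉ Λ') (a a' : Fin d)
    (x y : Λ → Fin d) : ω.siteRegion i Λ (a, x) (a', y) =
      ∑ z : ↥(Λ' \ Λ) → Fin d, ω.siteRegion i Λ' (a, glue x z) (a', glue y z) := by
  rw [siteRegion_apply, ← ω.consistent _ _ (Finset.insert_subset_insert i hΛ)]
  have hmem : ∀ j, j ∈ insert i Λ' \ insert i Λ ↔ j ∈ Λ' \ Λ := by
    intro j
    simp only [Finset.mem_sdiff, Finset.mem_insert, not_or]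
    constructor
    · rintro ⟨h | h, h1, h2⟩
      · exact absurd h h1
      · exact ⟨h, h2⟩
    · rintro ⟨h1, h2⟩
      exact ⟨Or.inr h1, fun h => hi (h ▸ h1), h2⟩
  have hglue : ∀ (b : Fin d) (w : Λ → Fin d) (z : ↥(insert i Λ' \ insert i Λ) → Fin d),
      glue (join i Λ (b, w)) z =
        join i Λ' (b, glue w fun j : ↥(Λ' \ Λ) => z ⟨j, (hmem j).2 j.2⟩) := by
    intro b w z
    funext j
    by_cases h1 : (j : ℤ) ∈ Λ
    · simp [glue, join, h1, hΛ h1]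
    · by_cases h2 : (j : ℤ) ∈ Λ'
      · have h3 : (j : ℤ) ≠ i := fun h => hi (h ▸ h2)
        simp [glue, join, h1, h2, h3]
      · have h3 : (j : ℤ) = i := (Finset.mem_insert.1 j.2).resolve_right h2
        simp [glue, join, h3, hi, show i ∉ Λ from fun h => hi (hΛ h)]
  refine Fintype.sum_equiv ((Equiv.subtypeEquivRight hmem).arrowCongr (Equiv.refl _)) _ _
    fun z => ?_
  rw [hglue, hglue]
  rfl

theorem rho_eq_sum_siteRegion {i : ℤ} {Λ : Finset ℤ} (hi : i ∉ Λ) (x y : Λ → Fin d) :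
    ω.rho Λ x y = ∑ a, ω.siteRegion i Λ (a, x) (a, y) := by
  rw [← ω.consistent _ _ (Finset.subset_insert i Λ)]
  have hmem : i ∈ insert i Λ \ Λ := by simp [hi]
  have : Unique ↥(insert i Λ \ Λ) :=
    { default := ⟨i, hmem⟩
      uniq := fun j => Subtype.ext (by
        have := Finset.mem_sdiff.1 j.2
        exact (Finset.mem_insert.1 this.1).resolve_right this.2) }
  refine Fintype.sum_equiv (Equiv.funUnique ↥(insert i Λ \ Λ) (Fin d)) _ _ fun z => ?_
  have hglue : ∀ w : Λ → Fin d, glue w z =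
      join i Λ (Equiv.funUnique ↥(insert i Λ \ Λ) (Fin d) z, w) := by
    intro w
    funext j
    by_cases h1 : (j : ℤ) ∈ Λ
    · simp [glue, join, h1]
    · simp only [glue, join, h1, dif_neg, not_false_iff, Equiv.funUnique_apply]
      exact congrArg z (Subsingleton.elim _ _)
  rw [siteRegion_apply, ← hglue, ← hglue]

theorem slice_one_siteRegion {i : ℤ} {Λ : Finset ℤ} (hi : i ∉ Λ) :
    slice 1 (ω.siteRegion i Λ) = ω.rho Λ := by
  ext x y
  rw [slice_one, of_apply, ← ω.rho_eq_sum_siteRegion hi]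

theorem restrict_slice_siteRegion (A : Matrix (Fin d) (Fin d) ℂ) {i : ℤ} {Λ Λ' : Finset ℤ}
    (hΛ : Λ ⊆ Λ') (hi : i ∉ Λ') :
    restrict Λ Λ' (slice A (ω.siteRegion i Λ')) = slice A (ω.siteRegion i Λ) := by
  ext x y
  simp only [restrict, slice, of_apply]
  rw [Finset.sum_comm]
  refine Finset.sum_congr rfl fun a _ => ?_
  rw [Finset.sum_comm]
  refine Finset.sum_congr rfl fun a' _ => ?_
  rw [ω.siteRegion_eq_sum hΛ hi, Finset.mul_sum]

/-- The density matrix of the single spin `i`. -/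
def siteDensity (i : ℤ) : Matrix (Fin d) (Fin d) ℂ :=
  partialTraceRight (ω.siteRegion i ∅)

theorem siteDensity_apply (i : ℤ) (a a' : Fin d) (x : ↥(∅ : Finset ℤ) → Fin d) :
    ω.siteDensity i a a' = ω.siteRegion i ∅ (a, x) (a', x) :=
  Fintype.sum_subsingleton (fun z => ω.siteRegion i ∅ (a, z) (a', z)) x

theorem partialTraceRight_siteRegion {i : ℤ} {Λ : Finset ℤ} (hi : i ∉ Λ) :
    partialTraceRight (ω.siteRegion i Λ) = ω.siteDensity i := by
  ext a a'
  rw [ω.siteDensity_apply i a a' fun j => absurd j.2 (Finset.notMem_empty _),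
    ω.siteRegion_eq_sum (Finset.empty_subset Λ) hi]
  have hmem : ∀ j, j ∈ Λ ↔ j ∈ Λ \ ∅ := by simp
  refine Fintype.sum_equiv ((Equiv.subtypeEquivRight hmem).arrowCongr (Equiv.refl _)) _ _
    fun z => ?_
  have : ∀ w : ↥(∅ : Finset ℤ) → Fin d, glue w
      ((Equiv.subtypeEquivRight hmem).arrowCongr (Equiv.refl _) z) = z := by
    intro w
    funext j
    simp only [glue, Finset.notMem_empty, dif_neg, not_false_iff]
    rfl
  rw [this]

variable {ω}

theorem IsTranslationInvariant.siteRegion_shift (hω : ω.IsTranslationInvariant) (i c : ℤ)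
    (Λ : Finset ℤ) (a a' : Fin d) (x y : ↥(shift Λ c) → Fin d) :
    ω.siteRegion (i + c) (shift Λ c) (a, x) (a', y) =
      ω.siteRegion i Λ (a, unshift x) (a', unshift y) := by
  have h : insert (i + c) (shift Λ c) = shift (insert i Λ) c :=
    (Finset.map_insert (addRightEmbedding c) i Λ).symm
  rw [siteRegion_apply, rho_congr ω h, hω, of_apply, siteRegion_apply]
  have hj : ∀ (b : Fin d) (w : ↥(shift Λ c) → Fin d),
      unshift (fun j : ↥(shift (insert i Λ) c) => join (i + c) (shift Λ c) (b, w) ⟨j, h.ge j.2⟩) =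
        join i Λ (b, unshift w) := by
    intro b w
    funext j
    have : (j : ℤ) + c ∈ shift Λ c ↔ (j : ℤ) ∈ Λ := by
      rw [shift]
      exact Finset.mem_map' (addRightEmbedding c)
    by_cases hj : (j : ℤ) ∈ Λ
    · simp [unshift, join, this, hj]
    · simp [unshift, join, this, hj]
  rw [hj, hj]

theorem IsTranslationInvariant.siteDensity_eq (hω : ω.IsTranslationInvariant) (i : ℤ) :
    ω.siteDensity i = ω.siteDensity 0 := by
  ext a a'
  let x : ↥(shift ∅ i) → Fin d := fun j => absurd j.2 (Finset.notMem_empty _)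
  have := hω.siteRegion_shift 0 i ∅ a a' x x
  rw [zero_add] at this
  rw [ω.siteDensity_apply 0 a a' (unshift x), ← this]
  exact ω.siteDensity_apply i a a' x

end ChainState

/-! ### Pure translation invariant states are clustering -/

namespace ChainState

variable {d : ℕ} (ω : ChainState d)

/-- The normalized limit of a sequence of families of matrices that are, eventually on each region,
positive, consistent and of trace `c`. -/
def limitState {U : Ultrafilter ℕ}
    (F : ℕ → (Λ : Finset ℤ) → Matrix (Λ → Fin d) (Λ → Fin d) ℂ)
    (L : (Λ : Finset ℤ) → Matrix (Λ → Fin d) (Λ → Fin d) ℂ)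
    {c : ℝ} (hc : 0 < c) (hL : ∀ Λ, Tendsto (fun k => F k Λ) U (𝓝 (L Λ)))
    (hpos : ∀ Λ, ∀ᶠ k in U, (F k Λ).PosSemidef)
    (htr : ∀ Λ, ∀ᶠ k in U, (F k Λ).trace = (c : ℂ))
    (hcons : ∀ Λ Λ', Λ ⊆ Λ' → ∀ᶠ k in U, restrict Λ Λ' (F k Λ') = F k Λ) : ChainState d where
  rho Λ := ((c⁻¹ : ℝ) : ℂ) • L Λ
  isDensity Λ := by
    constructor
    · refine (posSemidef_of_tendsto (hL Λ) (hpos Λ)).smul ?_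
      exact_mod_cast (inv_pos.2 hc).le
    · have h1 : Tendsto (fun k => (F k Λ).trace) U (𝓝 (L Λ).trace) :=
        (continuous_id.matrix_trace.tendsto (L Λ)).comp (hL Λ)
      have h2 : (L Λ).trace = c :=
        tendsto_nhds_unique_of_eventuallyEq h1 tendsto_const_nhds (htr Λ)
      rw [trace_smul, h2, smul_eq_mul, ← Complex.ofReal_mul, inv_mul_cancel₀ hc.ne',
        Complex.ofReal_one]
  consistent Λ Λ' hΛ := by
    have hentry : ∀ (Λ : Finset ℤ) x y, Tendsto (fun k => F k Λ x y) U (𝓝 (L Λ x y)) :=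
      fun Λ x y => tendsto_pi_nhds.1 (tendsto_pi_nhds.1 (hL Λ) x) y
    have h : restrict Λ Λ' (L Λ') = L Λ := by
      ext x y
      refine tendsto_nhds_unique_of_eventuallyEq
        (tendsto_finsetSum _ fun z _ => hentry Λ' (glue x z) (glue y z)) (hentry Λ x y) ?_
      filter_upwards [hcons Λ Λ' hΛ] with k hk
      exact congrFun (congrFun hk x) y
    ext x y
    rw [← h]
    simp [restrict, Finset.mul_sum]

theorem isDensityMatrix_siteDensity (i : ℤ) : IsDensityMatrix (ω.siteDensity i) := by
  constructor
  · have : ω.siteDensity i =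
        (ω.siteRegion i ∅).submatrix (fun a => (a, default)) fun a => (a, default) := by
      ext a a'
      rw [ω.siteDensity_apply i a a' default, submatrix_apply]
    rw [this]
    exact (ω.posSemidef_siteRegion _ _).submatrix _
  · have h2 := trace_slice 1 (ω.siteRegion i ∅)
    rw [ω.slice_one_siteRegion (Finset.notMem_empty i), (ω.isDensity ∅).2, one_mul] at h2
    exact h2.symm

theorem eventually_neg_notMem (Λ : Finset ℤ) : ∀ᶠ k : ℕ in atTop, -(k : ℤ) ∉ Λ := by
  obtain ⟨b, hb⟩ := Λ.bddBelow
  filter_upwards [eventually_gt_atTop (-b).toNat] with k hk hmem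
  have := hb hmem
  omega

variable {ω}

/-- If `0 ≤ A ≤ 1` has expectation strictly between `0` and `1`, then `ω` is a convex combination of the states obtained by
observing `A`, respectively `1 - A`, infinitely far to the left; purity makes both of them
equal to `ω`. -/
theorem IsPure.tendsto_slice_of_effect (hp : ω.IsPure) (hti : ω.IsTranslationInvariant)
    {A : Matrix (Fin d) (Fin d) ℂ} (hA : A.PosSemidef) (hA' : (1 - A).PosSemidef) {c : ℝ}
    (hc0 : 0 < c) (hc1 : c < 1) (hc : (A * ω.siteDensity 0).trace = c) (Λ : Finset ℤ) :
    Tendsto (fun k : ℕ => slice A (ω.siteRegion (-(k : ℤ)) Λ)) atTop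
      (𝓝 ((c : ℂ) • ω.rho Λ)) := by
  rw [tendsto_iff_ultrafilter]
  intro U hU
  have hbound : ∀ (B : Matrix (Fin d) (Fin d) ℂ) (Λ : Finset ℤ),
      ∃ L, Tendsto (fun k : ℕ => slice B (ω.siteRegion (-(k : ℤ)) Λ)) U (𝓝 L) := by
    intro B Λ
    refine exists_tendsto_of_norm_apply_le U _ (∑ a, ∑ a', ‖B a' a‖) fun k x y => ?_
    change ‖∑ a, ∑ a', B a' a * ω.siteRegion (-(k : ℤ)) Λ (a, x) (a', y)‖ ≤ _
    refine (norm_sum_le _ _).trans (Finset.sum_le_sum fun a _ => ?_)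
    refine (norm_sum_le _ _).trans (Finset.sum_le_sum fun a' _ => ?_)
    rw [norm_mul]
    exact mul_le_of_le_one_right (norm_nonneg _) ((ω.isDensity _).norm_apply_le_one _ _)
  choose L hL using hbound A
  choose L' hL' using hbound (1 - A)
  have hev : ∀ Λ : Finset ℤ, ∀ᶠ k : ℕ in U, -(k : ℤ) ∉ Λ := fun Λ => hU (eventually_neg_notMem Λ)
  have htr : ∀ (B : Matrix (Fin d) (Fin d) ℂ) (Λ : Finset ℤ), ∀ᶠ k : ℕ in U,
      (slice B (ω.siteRegion (-(k : ℤ)) Λ)).trace = (B * ω.siteDensity 0).trace := by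
    intro B Λ
    filter_upwards [hev Λ] with k hk
    rw [trace_slice, ω.partialTraceRight_siteRegion hk, hti.siteDensity_eq]
  have hcons : ∀ (B : Matrix (Fin d) (Fin d) ℂ) (Λ Λ' : Finset ℤ), Λ ⊆ Λ' → ∀ᶠ k : ℕ in U,
      restrict Λ Λ' (slice B (ω.siteRegion (-(k : ℤ)) Λ')) =
        slice B (ω.siteRegion (-(k : ℤ)) Λ) := by
    intro B Λ Λ' hΛ
    filter_upwards [hev Λ'] with k hk
    exact ω.restrict_slice_siteRegion B hΛ hk
  have hc' : ((1 - A) * ω.siteDensity 0).trace = ((1 - c : ℝ) : ℂ) := by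
    rw [Matrix.sub_mul, one_mul, trace_sub, hc, (ω.isDensityMatrix_siteDensity 0).2]
    push_cast
    rfl
  have hsum : ∀ Λ, L Λ + L' Λ = ω.rho Λ := by
    intro Λ
    refine tendsto_nhds_unique_of_eventuallyEq ((hL Λ).add (hL' Λ)) tendsto_const_nhds ?_
    filter_upwards [hev Λ] with k hk
    rw [← slice_add, add_sub_cancel, ω.slice_one_siteRegion hk]
  let φ := limitState (fun k Λ => slice A (ω.siteRegion (-(k : ℤ)) Λ)) L hc0 hL
    (fun Λ => Eventually.of_forall fun k => posSemidef_slice hA (ω.posSemidef_siteRegion _ _))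
    (fun Λ => (htr A Λ).mono fun k hk => hk.trans hc) (hcons A)
  let ψ := limitState (fun k Λ => slice (1 - A) (ω.siteRegion (-(k : ℤ)) Λ)) L'
    (sub_pos.2 hc1) hL'
    (fun Λ => Eventually.of_forall fun k => posSemidef_slice hA' (ω.posSemidef_siteRegion _ _))
    (fun Λ => (htr (1 - A) Λ).mono fun k hk => hk.trans hc') (hcons (1 - A))
  have hφL : ∀ Λ, (c : ℂ) • φ.rho Λ = L Λ := by
    intro Λ
    change (c : ℂ) • ((c⁻¹ : ℝ) : ℂ) • L Λ = L Λ
    rw [smul_smul, ← Complex.ofReal_mul, mul_inv_cancel₀ hc0.ne', Complex.ofReal_one, one_smul]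
  have hψL : ∀ Λ, ((1 - c : ℝ) : ℂ) • ψ.rho Λ = L' Λ := by
    intro Λ
    change ((1 - c : ℝ) : ℂ) • (((1 - c)⁻¹ : ℝ) : ℂ) • L' Λ = L' Λ
    rw [smul_smul, ← Complex.ofReal_mul, mul_inv_cancel₀ (sub_pos.2 hc1).ne', Complex.ofReal_one,
      one_smul]
  have hφ : φ = ω := (hp φ ψ c hc0 hc1 fun Λ => by rw [hφL, hψL, hsum]).1
  have := hL Λ
  rwa [← hφL, hφ] at this

/-- Clustering: a spin far to the left is asymptotically uncorrelated with the region `Λ`. -/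
theorem IsPure.tendsto_slice (hp : ω.IsPure) (hti : ω.IsTranslationInvariant)
    (A : Matrix (Fin d) (Fin d) ℂ) (Λ : Finset ℤ) :
    Tendsto (fun k : ℕ => slice A (ω.siteRegion (-(k : ℤ)) Λ)) atTop
      (𝓝 ((A * ω.siteDensity 0).trace • ω.rho Λ)) := by
  have hdens := ω.isDensityMatrix_siteDensity 0
  have hone : Tendsto (fun k : ℕ => slice 1 (ω.siteRegion (-(k : ℤ)) Λ)) atTop
      (𝓝 (ω.rho Λ)) := by
    refine tendsto_const_nhds.congr' ?_
    filter_upwards [eventually_neg_notMem Λ] with k hk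
    rw [ω.slice_one_siteRegion hk]
  have hherm : ∀ H : Matrix (Fin d) (Fin d) ℂ, H.IsHermitian →
      Tendsto (fun k : ℕ => slice H (ω.siteRegion (-(k : ℤ)) Λ)) atTop
        (𝓝 ((H * ω.siteDensity 0).trace • ω.rho Λ)) := by
    intro H hH
    obtain ⟨t, ht, h1, h2⟩ := exists_bound_of_isHermitian hH
    -- `1/2 + H / (4t)` lies between `1/4` and `3/4`, so its expectation is neither `0` nor `1`
    set s : ℝ := (4 * t)⁻¹ with hs
    have hs0 : 0 < s := by positivity
    have hst : s * t = 1 / 4 := by rw [hs]; field_simp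
    set B : Matrix (Fin d) (Fin d) ℂ := ((1 / 2 : ℝ) : ℂ) • 1 + (s : ℂ) • H with hB
    have hstC : (s : ℂ) * t = ((1 / 4 : ℝ) : ℂ) := by rw [← hst]; push_cast; rfl
    have hB1 : B = ((1 / 4 : ℝ) : ℂ) • 1 + (s : ℂ) • ((t : ℂ) • 1 + H) := by
      rw [hB, smul_add, smul_smul, hstC, ← add_assoc, ← add_smul]
      congr 2
      push_cast
      norm_num
    have hB2 : 1 - B = ((1 / 4 : ℝ) : ℂ) • 1 + (s : ℂ) • ((t : ℂ) • 1 - H) := by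
      rw [hB, smul_sub, smul_smul, hstC, ← add_sub_assoc, ← add_smul, ← sub_sub]
      congr 1
      nth_rewrite 1 [← one_smul ℂ (1 : Matrix (Fin d) (Fin d) ℂ)]
      rw [← sub_smul]
      congr 1
      push_cast
      norm_num
    have hq : ((1 / 4 : ℝ) : ℂ) • (1 : Matrix (Fin d) (Fin d) ℂ) |>.PosSemidef :=
      PosSemidef.one.smul (by exact_mod_cast (by norm_num : (0 : ℝ) ≤ 1 / 4))
    have hsC : (0 : ℂ) ≤ s := by exact_mod_cast hs0.le
    have hBpos : B.PosSemidef := hB1 ▸ hq.add (h2.smul hsC)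
    have hBpos' : (1 - B).PosSemidef := hB2 ▸ hq.add (h1.smul hsC)
    have hexp : ∀ M : Matrix (Fin d) (Fin d) ℂ, M.PosSemidef →
        1 / 4 ≤ (((((1 / 4 : ℝ) : ℂ) • 1 + (s : ℂ) • M) * ω.siteDensity 0).trace).re := by
      intro M hM
      rw [Matrix.add_mul, Matrix.smul_mul, Matrix.smul_mul, one_mul, trace_add, trace_smul,
        trace_smul, hdens.2, Complex.add_re, smul_eq_mul, smul_eq_mul, Complex.re_ofReal_mul,
        Complex.re_ofReal_mul, Complex.one_re]
      have := mul_nonneg hs0.le (re_trace_mul_nonneg hM hdens.1)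
      linarith
    have e1 := hexp _ h2
    have e2 := hexp _ h1
    rw [← hB1] at e1
    rw [← hB2, Matrix.sub_mul, one_mul, trace_sub, hdens.2, Complex.sub_re, Complex.one_re] at e2
    have him : ((B * ω.siteDensity 0).trace).im = 0 := by
      have h : star ((B * ω.siteDensity 0).trace) = (B * ω.siteDensity 0).trace := by
        rw [← trace_conjTranspose, conjTranspose_mul, hBpos.1.eq, hdens.1.1.eq, trace_mul_comm]
      rwa [Complex.star_def, Complex.conj_eq_iff_im] at h
    have hc : (B * ω.siteDensity 0).trace = ((B * ω.siteDensity 0).trace.re : ℂ) :=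
      Complex.ext (by simp) (by simp [him])
    have key := hp.tendsto_slice_of_effect hti hBpos hBpos' (by linarith) (by linarith) hc Λ
    rw [← hc] at key
    have hHB : H = (s : ℂ)⁻¹ • (B + (-((1 / 2 : ℝ) : ℂ)) • 1) := by
      rw [hB, neg_smul, add_neg_cancel_comm, smul_smul, inv_mul_cancel₀ (by exact_mod_cast hs0.ne'),
        one_smul]
    have h3 := (key.add (hone.const_smul (-((1 / 2 : ℝ) : ℂ)))).const_smul ((s : ℂ)⁻¹)
    have hl : ∀ k : ℕ, slice H (ω.siteRegion (-(k : ℤ)) Λ) =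
        (s : ℂ)⁻¹ • (slice B (ω.siteRegion (-(k : ℤ)) Λ) +
          (-((1 / 2 : ℝ) : ℂ)) • slice 1 (ω.siteRegion (-(k : ℤ)) Λ)) := by
      intro k
      rw [← slice_smul, ← slice_add, ← slice_smul, ← hHB]
    have hr : (H * ω.siteDensity 0).trace • ω.rho Λ = (s : ℂ)⁻¹ •
        ((B * ω.siteDensity 0).trace • ω.rho Λ + (-((1 / 2 : ℝ) : ℂ)) • ω.rho Λ) := by
      conv_lhs => rw [hHB]
      rw [Matrix.smul_mul, Matrix.add_mul, Matrix.smul_mul, one_mul, trace_smul, trace_add,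
        trace_smul, hdens.2, ← add_smul, smul_smul, smul_eq_mul, smul_eq_mul, mul_one]
    rw [hr]
    exact h3.congr fun k => (hl k).symm
  have hdec := realPart_add_I_smul_imaginaryPart A
  have h1 := hherm (realPart A) (realPart A).2
  have h2 := hherm (imaginaryPart A) (imaginaryPart A).2
  have h3 := h1.add (h2.const_smul Complex.I)
  have hr : (A * ω.siteDensity 0).trace • ω.rho Λ =
      (((realPart A : Matrix (Fin d) (Fin d) ℂ)) * ω.siteDensity 0).trace • ω.rho Λ +
      Complex.I • (((imaginaryPart A : Matrix (Fin d) (Fin d) ℂ)) * ω.siteDensity 0).trace •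
        ω.rho Λ := by
    conv_lhs => rw [← hdec]
    rw [Matrix.add_mul, Matrix.smul_mul, trace_add, trace_smul, add_smul, smul_smul, smul_eq_mul]
  rw [hr]
  refine h3.congr fun k => ?_
  rw [← slice_smul, ← slice_add, hdec]

/-- The joint density matrix of the region `Λ` and a spin that moves to `-∞` converges to the
product of the marginals. -/
theorem IsPure.tendsto_siteRegion (hp : ω.IsPure) (hti : ω.IsTranslationInvariant)
    (Λ : Finset ℤ) :
    Tendsto (fun k : ℕ => ω.siteRegion (-(k : ℤ)) Λ) atTop
      (𝓝 (ω.siteDensity 0 ⊗ₖ ω.rho Λ)) := by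
  refine tendsto_pi_nhds.2 ?_
  rintro ⟨a, x⟩
  refine tendsto_pi_nhds.2 ?_
  rintro ⟨a', y⟩
  have h := tendsto_pi_nhds.1 (tendsto_pi_nhds.1 (hp.tendsto_slice hti (single a' a 1) Λ) x) y
  simp only [slice_single] at h
  have hr : ((single a' a (1 : ℂ) * ω.siteDensity 0).trace • ω.rho Λ) x y =
      (ω.siteDensity 0 ⊗ₖ ω.rho Λ) (a, x) (a', y) := by
    rw [kronecker_apply, Matrix.smul_apply, smul_eq_mul, trace_single_mul]
    simp
  rwa [hr] at h

end ChainState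

/-! ### Expectations of elementary tensors -/

section Tensor

variable {d : ℕ}

theorem glue_bijective {Λ Λ' : Finset ℤ} (hΛ : Λ ⊆ Λ') :
    Function.Bijective fun s : (Λ → Fin d) × (↥(Λ' \ Λ) → Fin d) =>
      (glue s.1 s.2 : Λ' → Fin d) := by
  refine Function.bijective_iff_has_inverse.2 ⟨fun x => (fun j => x ⟨j, hΛ j.2⟩,
    fun j => x ⟨j, (Finset.mem_sdiff.1 j.2).1⟩), fun s => ?_, fun x => ?_⟩
  · refine Prod.ext (funext fun j => ?_) (funext fun j => ?_)
    · simp [glue]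
    · simp [glue, (Finset.mem_sdiff.1 j.2).2]
  · funext j
    by_cases hj : (j : ℤ) ∈ Λ <;> simp [glue, hj]

/-- Elementary tensors factorize over `Λ` and its complement in `Λ'`. -/
theorem tensor_glue {Λ Λ' : Finset ℤ} (hΛ : Λ ⊆ Λ') (A : ℤ → Matrix (Fin d) (Fin d) ℂ)
    (x y : Λ → Fin d) (z w : ↥(Λ' \ Λ) → Fin d) :
    tensor Λ' A (glue x z) (glue y w) = tensor Λ A x y * tensor (Λ' \ Λ) A z w := by
  simp only [tensor, of_apply]
  refine Eq.trans (Eq.symm ?_) (Fintype.prod_sum_type (Sum.elim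
    (fun j : Λ => A j (x j) (y j)) (fun j : ↥(Λ' \ Λ) => A j (z j) (w j))))
  refine Fintype.prod_bijective (Sum.elim (fun j => ⟨j, hΛ j.2⟩)
    (fun j => ⟨j, (Finset.mem_sdiff.1 j.2).1⟩)) ⟨?_, ?_⟩ _ _ ?_
  · rintro (j | j) (j' | j') h
    · exact congrArg Sum.inl (Subtype.ext (Subtype.mk.inj h))
    · exact absurd ((congrArg Subtype.val h : (j : ℤ) = j') ▸ j.2) (Finset.mem_sdiff.1 j'.2).2
    · exact absurd ((congrArg Subtype.val h : (j : ℤ) = j') ▸ j'.2) (Finset.mem_sdiff.1 j.2).2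
    · exact congrArg Sum.inr (Subtype.ext (Subtype.mk.inj h))
  · intro j
    by_cases hj : (j : ℤ) ∈ Λ
    · exact ⟨Sum.inl ⟨j, hj⟩, rfl⟩
    · exact ⟨Sum.inr ⟨j, Finset.mem_sdiff.2 ⟨j.2, hj⟩⟩, rfl⟩
  · rintro (j | j)
    · simp [glue]
    · simp [glue, (Finset.mem_sdiff.1 j.2).2]

theorem tensor_eq_one {Λ : Finset ℤ} {A : ℤ → Matrix (Fin d) (Fin d) ℂ}
    (hA : ∀ j ∈ Λ, A j = 1) : tensor Λ A = 1 := by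
  ext x y
  simp only [tensor, of_apply]
  rw [Finset.prod_congr rfl fun j _ => by rw [hA j j.2]]
  by_cases h : x = y
  · subst h; simp
  · rw [one_apply_ne h]
    obtain ⟨j, hj⟩ := Function.ne_iff.1 h
    exact Finset.prod_eq_zero (Finset.mem_univ j) (one_apply_ne hj)

theorem tensor_join {i : ℤ} {Λ : Finset ℤ} (hi : i ∉ Λ) (A : ℤ → Matrix (Fin d) (Fin d) ℂ)
    (s t : Fin d × (Λ → Fin d)) :
    tensor (insert i Λ) A (ChainState.join i Λ s) (ChainState.join i Λ t) =
      (A i ⊗ₖ tensor Λ A) s t := by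
  refine Eq.trans (Eq.symm ?_) (Fintype.prod_option (fun j : Option Λ =>
    j.elim (A i s.1 t.1) fun j => A j (s.2 j) (t.2 j)))
  refine Fintype.prod_bijective (fun j : Option Λ =>
    j.elim ⟨i, Finset.mem_insert_self _ _⟩ fun j => ⟨j, Finset.mem_insert_of_mem j.2⟩)
    ⟨?_, ?_⟩ _ _ ?_
  · rintro (_ | j) (_ | j') h
    · rfl
    · exact (hi ((Subtype.mk.inj h : i = j').symm ▸ j'.2)).elim
    · exact (hi ((Subtype.mk.inj h : (j : ℤ) = i) ▸ j.2)).elim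
    · exact congrArg some (Subtype.ext (Subtype.mk.inj h))
  · intro j
    by_cases hj : (j : ℤ) ∈ Λ
    · exact ⟨some ⟨j, hj⟩, rfl⟩
    · exact ⟨none, Subtype.ext ((Finset.mem_insert.1 j.2).resolve_right hj).symm⟩
  · rintro (_ | j)
    · simp [ChainState.join, hi]
    · simp [ChainState.join]

theorem unshift_bijective (Λ : Finset ℤ) (k : ℤ) :
    Function.Bijective (unshift (d := d) (Λ := Λ) (k := k)) := by
  have hmem : ∀ j : ↥(shift Λ k), (j : ℤ) - k ∈ Λ := by
    intro j
    obtain ⟨l, hl, h⟩ := Finset.mem_map.1 j.2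
    have : (j : ℤ) = l + k := h.symm
    rwa [this, add_sub_cancel_right]
  refine Function.bijective_iff_has_inverse.2 ⟨fun x j => x ⟨j - k, hmem j⟩, fun x => ?_,
    fun x => ?_⟩
  · funext j
    simp [unshift]
  · funext j
    simp [unshift]

theorem tensor_unshift {Λ : Finset ℤ} {k : ℤ} (A : ℤ → Matrix (Fin d) (Fin d) ℂ)
    (x y : ↥(shift Λ k) → Fin d) :
    tensor Λ (fun j => A (j + k)) (unshift x) (unshift y) = tensor (shift Λ k) A x y := by
  simp only [tensor, of_apply]
  refine Fintype.prod_bijective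
    (fun j : Λ => (⟨j + k, Finset.mem_map_of_mem (addRightEmbedding k) j.2⟩ : ↥(shift Λ k)))
    ⟨?_, ?_⟩ _ _ fun j => rfl
  · intro j j' h
    exact Subtype.ext (add_right_cancel (congrArg Subtype.val h))
  · intro j
    obtain ⟨l, hl, h⟩ := Finset.mem_map.1 j.2
    exact ⟨⟨l, hl⟩, Subtype.ext h⟩

theorem tensor_single {Λ : Finset ℤ} (x y : Λ → Fin d) {A : ℤ → Matrix (Fin d) (Fin d) ℂ}
    (hA : ∀ j : Λ, A j = single (x j) (y j) 1) : tensor Λ A = single x y 1 := by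
  ext x' y'
  simp only [tensor, of_apply, hA, single_apply]
  by_cases h : x = x' ∧ y = y'
  · obtain ⟨rfl, rfl⟩ := h
    simp
  · rw [if_neg h]
    rw [not_and_or, ← ne_eq, ← ne_eq, Function.ne_iff, Function.ne_iff] at h
    rcases h with ⟨j, hj⟩ | ⟨j, hj⟩
    · exact Finset.prod_eq_zero (Finset.mem_univ j) (if_neg fun h => hj h.1)
    · exact Finset.prod_eq_zero (Finset.mem_univ j) (if_neg fun h => hj h.2)

end Tensor

namespace ChainState

variable {d : ℕ} (ω : ChainState d)

/-- The expectation of the elementary tensor `⊗_{j ∈ Λ} A j`. -/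
def expect (Λ : Finset ℤ) (A : ℤ → Matrix (Fin d) (Fin d) ℂ) : ℂ :=
  (ω.rho Λ * tensor Λ A).trace

theorem expect_of_subset {Λ Λ' : Finset ℤ} (hΛ : Λ ⊆ Λ') {A : ℤ → Matrix (Fin d) (Fin d) ℂ}
    (hA : ∀ j ∈ Λ' \ Λ, A j = 1) : ω.expect Λ' A = ω.expect Λ A := by
  have hsum : ∀ f : (Λ' → Fin d) → ℂ, ∑ x, f x =
      ∑ x : Λ → Fin d, ∑ z : ↥(Λ' \ Λ) → Fin d, f (glue x z) := by
    intro f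
    rw [← Fintype.sum_bijective _ (glue_bijective hΛ) _ f fun s => rfl, Fintype.sum_prod_type]
  simp only [expect, trace, diag_apply, mul_apply]
  rw [hsum]
  simp only [hsum, tensor_glue hΛ, tensor_eq_one hA, one_apply, mul_ite, mul_one, mul_zero,
    Finset.sum_ite_eq', Finset.mem_univ, if_true]
  refine Finset.sum_congr rfl fun x _ => ?_
  rw [Finset.sum_comm]
  refine Finset.sum_congr rfl fun y _ => ?_
  rw [← ω.consistent Λ Λ' hΛ, restrict, of_apply, Finset.sum_mul]

theorem expect_insert {i : ℤ} {Λ : Finset ℤ} (hi : i ∉ Λ) (A : ℤ → Matrix (Fin d) (Fin d) ℂ) :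
    ω.expect (insert i Λ) A = (ω.siteRegion i Λ * (A i ⊗ₖ tensor Λ A)).trace := by
  have hsum : ∀ f : (↥(insert i Λ) → Fin d) → ℂ, ∑ x, f x = ∑ s, f (join i Λ s) := fun f =>
    (Fintype.sum_bijective _ (join_bijective hi) _ f fun s => rfl).symm
  simp only [expect, trace, diag_apply, mul_apply, hsum, tensor_join hi, siteRegion_apply]

variable {ω}

theorem IsTranslationInvariant.expect_shift (hω : ω.IsTranslationInvariant) (Λ : Finset ℤ) (k : ℤ)
    (A : ℤ → Matrix (Fin d) (Fin d) ℂ) :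
    ω.expect (shift Λ k) A = ω.expect Λ fun j => A (j + k) := by
  have hsum : ∀ f : (Λ → Fin d) → ℂ, ∑ x, f x =
      ∑ x : ↥(shift Λ k) → Fin d, f (unshift x) := fun f =>
    (Fintype.sum_bijective _ (unshift_bijective Λ k) _ f fun s => rfl).symm
  simp only [expect, trace, diag_apply, mul_apply, hsum, tensor_unshift]
  rw [hω]
  rfl

end ChainState

/-! ### Finitely correlated states -/

section Transfer

variable {d b : ℕ}
  (E : Matrix (Fin d × Fin b) (Fin d × Fin b) ℂ →ₗ[ℂ] Matrix (Fin b) (Fin b) ℂ)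

/-- The transfer operator `B ↦ 𝔼 (1 ⊗ B)` on the memory. -/
def transfer : Matrix (Fin b) (Fin b) ℂ →ₗ[ℂ] Matrix (Fin b) (Fin b) ℂ where
  toFun B := E ((1 : Matrix (Fin d) (Fin d) ℂ) ⊗ₖ B)
  map_add' B B' := by rw [kronecker_add, map_add]
  map_smul' c B := by rw [kronecker_smul, map_smul, RingHom.id_apply]

/-- The ampliation `id ⊗ 𝔼 (1 ⊗ ·)` of the transfer operator to one spin and the memory. -/
def ampliatedTransfer : Matrix (Fin d × Fin b) (Fin d × Fin b) ℂ →ₗ[ℂ]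
    Matrix (Fin d × Fin b) (Fin d × Fin b) ℂ where
  toFun X := of fun s t => transfer E (of fun i j => X (s.1, i) (t.1, j)) s.2 t.2
  map_add' X Y := by
    ext s t
    exact congrFun (congrFun (map_add (transfer E) (of fun i j => X (s.1, i) (t.1, j))
      (of fun i j => Y (s.1, i) (t.1, j))) s.2) t.2
  map_smul' c X := by
    ext s t
    exact congrFun (congrFun (map_smul (transfer E) c (of fun i j => X (s.1, i) (t.1, j))) s.2) t.2

theorem ampliatedTransfer_kronecker (A : Matrix (Fin d) (Fin d) ℂ) (B : Matrix (Fin b) (Fin b) ℂ) :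
    ampliatedTransfer E (A ⊗ₖ B) = A ⊗ₖ transfer E B := by
  ext s t
  exact congrFun (congrFun (map_smul (transfer E) (A s.1 t.1) B) s.2) t.2

theorem ampliatedTransfer_pow_kronecker (k : ℕ) (A : Matrix (Fin d) (Fin d) ℂ)
    (B : Matrix (Fin b) (Fin b) ℂ) :
    (ampliatedTransfer E ^ k) (A ⊗ₖ B) = A ⊗ₖ (transfer E ^ k) B := by
  induction k generalizing B with
  | zero => rfl
  | succ k ih =>
    rw [pow_succ, pow_succ, Module.End.mul_apply, Module.End.mul_apply,
      ampliatedTransfer_kronecker, ih]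

theorem nested_replicate_append (k : ℕ) (l : List (Matrix (Fin d) (Fin d) ℂ)) :
    nested E (List.replicate k 1 ++ l) = (transfer E ^ k) (nested E l) := by
  induction k with
  | zero => rfl
  | succ k ih =>
    rw [pow_succ', Module.End.mul_apply, ← ih]
    rfl

end Transfer

namespace ChainState

variable {d : ℕ} {ω : ChainState d}

/-- In a finitely correlated state, all correlations of a spin with a block, as functions of their
distance `k`, are orbit sequences `F (Φ ^ k v)` of one operator on a finite-dimensional space. -/
theorem IsFinitelyCorrelated.exists_orbit (hfcs : ω.IsFinitelyCorrelated)
    (hti : ω.IsTranslationInvariant) :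
    ∃ (b : ℕ) (Φ : Matrix (Fin d × Fin b) (Fin d × Fin b) ℂ →ₗ[ℂ]
        Matrix (Fin d × Fin b) (Fin d × Fin b) ℂ)
      (F : Matrix (Fin d × Fin b) (Fin d × Fin b) ℂ →ₗ[ℂ] ℂ),
      ∀ (m : ℕ) (S : Matrix (Fin d × (↥(Finset.Icc (1 : ℤ) m) → Fin d))
        (Fin d × (↥(Finset.Icc (1 : ℤ) m) → Fin d)) ℂ), ∃ v, ∀ k : ℕ,
          (S * ω.siteRegion (-(k : ℤ)) (Finset.Icc (1 : ℤ) m)).trace = F ((Φ ^ k) v) := by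
  obtain ⟨b, E, ρ, -, -, -, -, hE⟩ := hfcs
  let F : Matrix (Fin d × Fin b) (Fin d × Fin b) ℂ →ₗ[ℂ] ℂ :=
    { toFun := fun X => (ρ * E X).trace
      map_add' := fun X Y => by rw [map_add, Matrix.mul_add, trace_add]
      map_smul' := fun c X => by
        rw [map_smul, Matrix.mul_smul, trace_smul, RingHom.id_apply] }
  refine ⟨b, ampliatedTransfer E, F, fun m S => ?_⟩
  -- on an elementary tensor the `k` intermediate spins contribute `k` transfer operators
  have helem : ∀ (A₀ : Matrix (Fin d) (Fin d) ℂ) (B : ℤ → Matrix (Fin d) (Fin d) ℂ) (k : ℕ),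
      ((A₀ ⊗ₖ tensor (Finset.Icc (1 : ℤ) m) B) *
        ω.siteRegion (-(k : ℤ)) (Finset.Icc (1 : ℤ) m)).trace =
      F ((ampliatedTransfer E ^ k)
        (A₀ ⊗ₖ nested E ((List.range m).map fun i : ℕ => B ((i : ℤ) + 1)))) := by
    intro A₀ B k
    set A : ℤ → Matrix (Fin d) (Fin d) ℂ :=
      fun j => if j = -(k : ℤ) then A₀ else if j ≤ 0 then 1 else B j with hA
    have hk : -(k : ℤ) ∉ Finset.Icc (1 : ℤ) m := by simp; omega
    have hA0 : A (-(k : ℤ)) = A₀ := if_pos rfl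
    have hAB : ∀ j : ℤ, 1 ≤ j → A j = B j := fun j hj => by
      simp only [hA]
      rw [if_neg (by omega), if_neg (by omega)]
    have htens : tensor (Finset.Icc (1 : ℤ) m) A = tensor (Finset.Icc (1 : ℤ) m) B := by
      ext x y
      simp only [tensor, of_apply]
      exact Finset.prod_congr rfl fun j _ => by rw [hAB j (Finset.mem_Icc.1 j.2).1]
    have hshift : Finset.Icc (-(k : ℤ)) m =
        shift (Finset.Icc (1 : ℤ) ((k + 1 + m : ℕ) : ℤ)) (-(k + 1 : ℤ)) := by
      rw [shift, Finset.map_add_right_Icc]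
      congr 1 <;> push_cast <;> ring
    have hlist : ((List.range (k + 1 + m)).map fun i : ℕ => A ((i : ℤ) + 1 + -(k + 1 : ℤ))) =
        A₀ :: (List.replicate k 1 ++ (List.range m).map fun i : ℕ => B ((i : ℤ) + 1)) := by
      rw [List.range_add, List.map_append, List.range_succ_eq_map, List.map_cons, List.cons_append]
      congr 1
      · rw [← hA0]
        congr 1
        push_cast
        ring
      · congr 1
        · rw [List.map_map, List.eq_replicate_iff]
          refine ⟨by simp, fun M hM => ?_⟩
          obtain ⟨i, hi, rfl⟩ := List.mem_map.1 hM
          have := List.mem_range.1 hi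
          simp only [Function.comp_apply, hA]
          rw [if_neg (by push_cast; omega), if_pos (by push_cast; omega)]
        · rw [List.map_map]
          refine List.map_congr_left fun i _ => ?_
          rw [← hAB _ (by omega)]
          simp only [Function.comp_apply]
          congr 1
          push_cast
          ring
    calc _ = ω.expect (insert (-(k : ℤ)) (Finset.Icc (1 : ℤ) m)) A := by
          rw [ω.expect_insert hk, hA0, htens, trace_mul_comm]
      _ = ω.expect (Finset.Icc (-(k : ℤ)) m) A := by
          refine (ω.expect_of_subset ?_ ?_).symm
          · intro j hj
            simp only [Finset.mem_insert, Finset.mem_Icc] at hj ⊢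
            omega
          · intro j hj
            simp only [Finset.mem_sdiff, Finset.mem_insert, Finset.mem_Icc] at hj
            simp only [hA]
            rw [if_neg (by omega), if_pos (by omega)]
      _ = ω.expect (Finset.Icc (1 : ℤ) ((k + 1 + m : ℕ) : ℤ)) fun j => A (j + -(k + 1 : ℤ)) := by
          rw [hshift, hti.expect_shift]
      _ = (ρ * nested E ((List.range (k + 1 + m)).map
            fun i : ℕ => A ((i : ℤ) + 1 + -(k + 1 : ℤ)))).trace := hE _ _
      _ = _ := by
          rw [hlist, ampliatedTransfer_pow_kronecker, ← nested_replicate_append]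
          rfl
  have hsingle : ∀ s t, ∃ v, ∀ k : ℕ,
      (single s t (1 : ℂ) * ω.siteRegion (-(k : ℤ)) (Finset.Icc (1 : ℤ) m)).trace =
        F ((ampliatedTransfer E ^ k) v) := by
    intro s t
    let B : ℤ → Matrix (Fin d) (Fin d) ℂ := fun j =>
      if h : j ∈ Finset.Icc (1 : ℤ) m then single (s.2 ⟨j, h⟩) (t.2 ⟨j, h⟩) 1 else 1
    have hB : single s t (1 : ℂ) = single s.1 t.1 1 ⊗ₖ tensor (Finset.Icc (1 : ℤ) m) B := by
      rw [tensor_single s.2 t.2 fun j => dif_pos j.2, single_kronecker_single, mul_one]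
    rw [hB]
    exact ⟨_, helem _ B⟩
  choose v hv using hsingle
  refine ⟨∑ s, ∑ t, S s t • v s t, fun k => ?_⟩
  conv_lhs => rw [matrix_eq_sum_single S]
  simp only [map_sum, map_smul, Finset.sum_mul, trace_sum, ← hv]
  refine Finset.sum_congr rfl fun s _ => Finset.sum_congr rfl fun t _ => ?_
  rw [← trace_smul, ← Matrix.smul_mul, smul_single, smul_eq_mul, mul_one]

end ChainState

/-! ### Exponential decay of the entanglement of formation -/

theorem norm_trace_mul_le_one {ι : Type*} [Fintype ι] [DecidableEq ι] {S M : Matrix ι ι ℂ}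
    (hS : (1 - S).PosSemidef) (hS' : (1 + S).PosSemidef) (hM : IsDensityMatrix M) :
    ‖(S * M).trace‖ ≤ 1 := by
  have h1 := re_trace_mul_nonneg hS hM.1
  have h2 := re_trace_mul_nonneg hS' hM.1
  rw [Matrix.sub_mul, one_mul, trace_sub, hM.2, Complex.sub_re, Complex.one_re] at h1
  rw [Matrix.add_mul, one_mul, trace_add, hM.2, Complex.add_re, Complex.one_re] at h2
  have hSh : S.IsHermitian := by
    have h := hS'.1.sub isHermitian_one
    rwa [add_sub_cancel_left] at h
  have him : ((S * M).trace).im = 0 := by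
    have h : star ((S * M).trace) = (S * M).trace := by
      rw [← trace_conjTranspose, conjTranspose_mul, hSh.eq, hM.1.1.eq, trace_mul_comm]
    rwa [Complex.star_def, Complex.conj_eq_iff_im] at h
  have hc : (S * M).trace = ((S * M).trace.re : ℂ) := Complex.ext (by simp) (by simp [him])
  rw [hc, Complex.norm_real, Real.norm_eq_abs, abs_le]
  constructor <;> linarith

namespace ChainState

variable {d : ℕ} {ω : ChainState d}

/-- The trace norm distance between the joint density matrix of a spin and a block, and the product
of the marginals, is exponentially small in their distance, uniformly in the block. -/
theorem IsPure.exists_norm_trace_le (hp : ω.IsPure) (hti : ω.IsTranslationInvariant)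
    (hfcs : ω.IsFinitelyCorrelated) :
    ∃ K r : ℝ, 0 ≤ K ∧ 0 < r ∧ r < 1 ∧ ∀ (k m : ℕ)
      (S : Matrix (Fin d × (↥(Finset.Icc (1 : ℤ) m) → Fin d))
        (Fin d × (↥(Finset.Icc (1 : ℤ) m) → Fin d)) ℂ),
      (1 - S).PosSemidef → (1 + S).PosSemidef →
        ‖(S * (ω.siteRegion (-(k : ℤ)) (Finset.Icc (1 : ℤ) m) -
          ω.siteDensity 0 ⊗ₖ ω.rho (Finset.Icc (1 : ℤ) m))).trace‖ ≤ K * r ^ k := by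
  obtain ⟨b, Φ, F, horbit⟩ := hfcs.exists_orbit hti
  -- an extra coordinate on which `Φ` acts trivially accounts for the limit of the sequence
  let Φ' := Φ.prodMap (LinearMap.id : ℂ →ₗ[ℂ] ℂ)
  let F' := F.coprod (-LinearMap.id : ℂ →ₗ[ℂ] ℂ)
  obtain ⟨K, r, hK, hr0, hr1, hb⟩ := exists_exponential_bound Φ' F'
  refine ⟨K * 2, r, by positivity, hr0, hr1, fun k m S hS hS' => ?_⟩
  set τ := ω.siteDensity 0 ⊗ₖ ω.rho (Finset.Icc (1 : ℤ) m) with hτ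
  have hτd : IsDensityMatrix τ := by
    refine ⟨(ω.isDensityMatrix_siteDensity 0).1.kronecker (ω.isDensity _).1, ?_⟩
    rw [hτ, trace_kronecker, (ω.isDensityMatrix_siteDensity 0).2, (ω.isDensity _).2, one_mul]
  obtain ⟨v, hv⟩ := horbit m S
  have hpow : ∀ (k : ℕ) w, (Φ' ^ k) w = ((Φ ^ k) w.1, w.2) := by
    intro k
    induction k with
    | zero => intro w; rfl
    | succ k ih =>
      intro w
      rw [pow_succ, Module.End.mul_apply, ih, pow_succ, Module.End.mul_apply]
      rfl
  have hF : ∀ k : ℕ, F' ((Φ' ^ k) (v, (S * τ).trace)) =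
      (S * (ω.siteRegion (-(k : ℤ)) (Finset.Icc (1 : ℤ) m) - τ)).trace := by
    intro k
    rw [hpow, Matrix.mul_sub, trace_sub, hv, LinearMap.coprod_apply, LinearMap.neg_apply,
      LinearMap.id_apply, sub_eq_add_neg]
  have hlim : Tendsto (fun k => F' ((Φ' ^ k) (v, (S * τ).trace))) atTop (𝓝 0) := by
    simp only [hF]
    have hcont : Continuous fun M : Matrix (Fin d × (↥(Finset.Icc (1 : ℤ) m) → Fin d))
        (Fin d × (↥(Finset.Icc (1 : ℤ) m) → Fin d)) ℂ => (S * (M - τ)).trace := by fun_prop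
    have := (hcont.tendsto τ).comp (hp.tendsto_siteRegion hti (Finset.Icc (1 : ℤ) m))
    simp only [sub_self, mul_zero, trace_zero] at this
    exact this
  have hbd : ∀ k, ‖F' ((Φ' ^ k) (v, (S * τ).trace))‖ ≤ 2 := by
    intro k
    rw [hF, Matrix.mul_sub, trace_sub]
    have hk : -(k : ℤ) ∉ Finset.Icc (1 : ℤ) m := by simp; omega
    have h1 := norm_trace_mul_le_one hS hS' (ω.isDensityMatrix_siteRegion hk)
    have h2 := norm_trace_mul_le_one hS hS' hτd
    exact (norm_sub_le _ _).trans (by linarith)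
  have := hb _ hlim 2 hbd k
  rw [hF] at this
  linarith

/-- The trace norm decays at rate `r`, hence the entanglement of formation at rate `√r`: by translation
invariance, spin `1` and the block `[p, n]` are at the same distance as spin `2 - p` and the block
`[1, n - p + 1]`. -/
theorem IsPure.exists_entanglementOfFormation_spinBlock_le (hp : ω.IsPure)
    (hti : ω.IsTranslationInvariant) (hfcs : ω.IsFinitelyCorrelated) :
    ∃ K r : ℝ, 0 ≤ K ∧ 0 < r ∧ r < 1 ∧ ∀ p n : ℕ, 2 ≤ p → p ≤ n →
      entanglementOfFormation (ω.spinBlock p n) ≤ K * r ^ p := by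
  obtain ⟨K, r, hK, hr0, hr1, hb⟩ := hp.exists_norm_trace_le hti hfcs
  refine ⟨2 * √(2 * d * K) / √r ^ 2, √r, by positivity, Real.sqrt_pos.2 hr0,
    (Real.sqrt_lt' one_pos).2 (by linarith), fun p n hp2 hpn => ?_⟩
  obtain ⟨k, rfl⟩ := Nat.exists_eq_add_of_le hp2
  obtain ⟨l, rfl⟩ := Nat.exists_eq_add_of_le hpn
  set Λ := Finset.Icc (1 : ℤ) ((l + 1 : ℕ) : ℤ) with hΛ
  set c : ℤ := (k : ℤ) + 1 with hc
  have hregion : Finset.Icc ((2 + k : ℕ) : ℤ) ((2 + k + l : ℕ) : ℤ) = shift Λ c := by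
    rw [shift, hΛ, Finset.map_add_right_Icc, hc]
    congr 1 <;> push_cast <;> ring
  have hsite : (1 : ℤ) = -(k : ℤ) + c := by rw [hc]; ring
  have heq : entanglementOfFormation (ω.spinBlock (2 + k) (2 + k + l)) =
      entanglementOfFormation (ω.siteRegion (-(k : ℤ) + c) (shift Λ c)) := by
    rw [spinBlock, hregion, ← hsite]
  have hnot : -(k : ℤ) + c ∉ shift Λ c := by
    rw [← hsite, ← hregion, Finset.mem_Icc]
    push_cast
    omega
  let e : (↥(shift Λ c) → Fin d) ≃ (Λ → Fin d) := Equiv.ofBijective _ (unshift_bijective Λ c)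
  let f : Fin d × (↥(shift Λ c) → Fin d) ≃ Fin d × (Λ → Fin d) := (Equiv.refl _).prodCongr e
  have hσ : ω.siteRegion (-(k : ℤ) + c) (shift Λ c) =
      (ω.siteRegion (-(k : ℤ)) Λ).submatrix f f := by
    ext s t
    exact hti.siteRegion_shift _ _ _ _ _ _ _
  have hτ : ω.siteDensity 0 ⊗ₖ (ω.rho Λ).submatrix e e =
      (ω.siteDensity 0 ⊗ₖ ω.rho Λ).submatrix f f := rfl
  rw [heq]
  refine (entanglementOfFormation_le_of_near_product (ω.isDensityMatrix_siteRegion hnot)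
    (ω.isDensityMatrix_siteDensity 0).1 ((ω.isDensity Λ).1.submatrix e) (δ := K * r ^ k)
    fun S hS hS' => ?_).trans ?_
  · have h1 : (1 - S.submatrix f.symm f.symm).PosSemidef := by
      rw [← submatrix_one_equiv f.symm]
      exact hS.submatrix f.symm
    have h2 : (1 + S.submatrix f.symm f.symm).PosSemidef := by
      rw [← submatrix_one_equiv f.symm]
      exact hS'.submatrix f.symm
    have htr : (S * (ω.siteRegion (-(k : ℤ) + c) (shift Λ c) -
        ω.siteDensity 0 ⊗ₖ (ω.rho Λ).submatrix e e)).trace =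
        (S.submatrix f.symm f.symm *
          (ω.siteRegion (-(k : ℤ)) Λ - ω.siteDensity 0 ⊗ₖ ω.rho Λ)).trace := by
      rw [hσ, hτ]
      simp only [trace, diag_apply, mul_apply]
      refine Fintype.sum_equiv f _ _ fun s => Fintype.sum_equiv f _ _ fun t => ?_
      simp
    rw [htr]
    exact (Complex.re_le_norm _).trans (hb k (l + 1) _ h1 h2)
  · rw [Fintype.card_fin]
    have h1 : √(2 * d * (K * r ^ k)) = √(2 * d * K) * √r ^ k := by
      have hr : r ^ k = (√r ^ k) ^ 2 := by
        rw [← pow_mul, mul_comm, pow_mul, Real.sq_sqrt hr0.le]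
      rw [← mul_assoc, Real.sqrt_mul (by positivity), hr, Real.sqrt_sq (by positivity)]
    rw [h1, pow_add]
    have : √r ^ 2 ≠ 0 := by positivity
    field_simp
    exact le_refl _

end ChainState

end SpinChain

end

theorem mainTheorem2 :
    ∃ C : ℝ, 0 < C ∧
      ∀ (d : ℕ) (ω : SpinChain.ChainState d),
        ω.IsTranslationInvariant → ω.IsPure → ω.IsFinitelyCorrelated →
          ∃ ε : ℕ → ℝ, SpinChain.DecaysExponentially ε ∧
            ∀ p n : ℕ, 2 ≤ p → p ≤ n →
              SpinChain.entanglementOfFormation (ω.spinBlock p n) ≤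
                C * Real.log d * ((n : ℝ) - p + 1) * ε p := by
  refine ⟨1, one_pos, fun d ω hti hp hfcs => ?_⟩
  rcases le_or_gt d 1 with hd | hd
  · -- `log d = 0`, and a spin of dimension at most one has no entanglement
    refine ⟨fun _ => 0, ⟨0, 1 / 2, by norm_num, by norm_num, fun p => by simp⟩, fun p n _ _ => ?_⟩
    have : Subsingleton (Fin d) := Fin.subsingleton_iff_le_one.2 hd
    rw [mul_zero]
    exact SpinChain.entanglementOfFormation_nonpos_of_subsingleton _
  · obtain ⟨K, r, hK, hr0, hr1, hb⟩ := hp.exists_entanglementOfFormation_spinBlock_le hti hfcs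
    have hlog : 0 < Real.log d := Real.log_pos (by exact_mod_cast hd)
    refine ⟨fun p => K / Real.log d * r ^ p, ⟨K / Real.log d, r, hr0, hr1, fun p =>
      ⟨by positivity, le_refl _⟩⟩, fun p n h2 hpn => ?_⟩
    have hn : (1 : ℝ) ≤ (n : ℝ) - p + 1 := by
      have : (p : ℝ) ≤ n := by exact_mod_cast hpn
      linarith
    calc SpinChain.entanglementOfFormation (ω.spinBlock p n) ≤ K * r ^ p := hb p n h2 hpn
      _ ≤ ((n : ℝ) - p + 1) * (K * r ^ p) := le_mul_of_one_le_left (by positivity) hn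
      _ = 1 * Real.log d * ((n : ℝ) - p + 1) * (K / Real.log d * r ^ p) := by
          field_simp
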